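/- Let $K$ be a field of characteristic zero and let $\mathfrak g$ be a Lie algebra over $K$ with a filtration $s$, i.e. a chain of ideals $\mathfrak g=\mathfrak g_0\supseteq\mathfrak g_1\supseteq\dots\supseteq\mathfrak g_k=\{0\}$ in which every $\mathfrak g_i$ has codimension at most $1$ in $\mathfrak g_{i-1}$ (so $\mathfrak g$ is finite dimensional and solvable). A $U(\mathfrak g,s)$-module is a representation $\rho$ of $\mathfrak g$ in a $K$-vector space $V$ together with a chain of subspaces $V=V_0\supseteq V_1\supseteq\dots\supseteq V_k$ such that $V_i$ is invariant under $\rho(\mathfrak g_i)$ for every $i$. Two such modules $V$, $W$ are equivalent if there is a $K$-linear isomorphism $C:V\to W$ that commutes with the actions of $\mathfrak g$ and satisfies $C(V_i)=W_i$ for all $i$. A $U(\mathfrak g,s)$-module is irreducible if every $V_i$ is an irreducible representation of $\mathfrak g_i$; $\mathrm{Irr}(\mathfrak g,s)$ denotes the set of equivalence classes of irreducible $U(\mathfrak g,s)$-modules. For $f\in\mathfrak g^*$ the Vergne polarization is $\mathfrak{pv}(f)=\sum_{i=0}^k\{x\in\mathfrak g_i : f([x,\mathfrak g_i])=0\}$.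 It is a Lie subalgebra on which $f$ restricts to a character. Let $M(f)=U(\mathfrak g)\otimes_{U(\mathfrak{pv}(f))}K$ be the $U(\mathfrak g)$-module induced from the character $f|_{\mathfrak{pv}(f)}$, let $l=1\otimes 1\in M(f)$, and let $M_s(f)$ be the $U(\mathfrak g,s)$-module $M(f)$ with the filtration by the subspaces $U(\mathfrak g_i)\,l$, $0\le i\le k$. Define an equivalence relation $\mathfrak R$ on $\mathfrak g^*$ by: $f'\,\mathfrak R\,f''$ if and only if $\mathfrak{pv}(f')=\mathfrak{pv}(f'')$ and $f'$, $f''$ coincide on this common Vergne polarization. Then for all $f',f''\in\mathfrak g^*$ the following conditions are equivalent: 1. $M(f')$ and $M(f'')$ are isomorphic as $U(\mathfrak g)$-modules; 2. $M_s(f')$ and $M_s(f'')$ are equivalent as $U(\mathfrak g,s)$-modules; 3. $\mathfrak{pv}(f')=\mathfrak{pv}(f'')$ and $f'$, $f''$ coincide on this common Vergne polarization. Moreover, every $M_s(f)$ is an irreducible $U(\mathfrak g,s)$-module, and $f\mapsto M_s(f)$ induces a well-defined injective map $\mathfrak g^*/\mathfrak R\to\mathrm{Irr}(\mathfrak g,s)$.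 If $K$ is algebraically closed, this map is a bijection. -/

import Mathlib

open scoped TensorProduct

universe u v

noncomputable section

namespace FiltLie

attribute [local instance 100] LieRing.ofAssociativeRing

section Basic

variable (K : Type u) [Field K] (L : Type v) [LieRing L] [LieAlgebra K L]

/-- A filtration of a Lie algebra: a chain of ideals `𝔤 = 𝔤₀ ⊇ 𝔤₁ ⊇ ⋯ ⊇ 𝔤ₖ = 0`, each of
codimension at most one in the preceding one; repetitions are allowed. (A Lie algebra with such a
chain is automatically finite dimensional and solvable.) -/
structure Filtration (k : ℕ) where
  /-- the ideal `𝔤ᵢ` -/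
  ideal : Fin (k + 1) → LieIdeal K L
  antitone : Antitone ideal
  ideal_zero : ideal 0 = ⊤
  ideal_last : ideal (Fin.last k) = ⊥
  codim_le_one : ∀ i : Fin k,
    Module.rank K (↥(ideal i.castSucc).toSubmodule ⧸
      (ideal i.succ).toSubmodule.submoduleOf (ideal i.castSucc).toSubmodule) ≤ 1

end Basic

section Induced

variable {K : Type u} [Field K] {L : Type v} [LieRing L] [LieAlgebra K L]

/-- The algebra homomorphism `U(𝔥) → U(𝔤)` induced by the inclusion of a Lie subalgebra. -/
def envIncl (𝔥 : LieSubalgebra K L) :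
    UniversalEnvelopingAlgebra K 𝔥 →ₐ[K] UniversalEnvelopingAlgebra K L :=
  UniversalEnvelopingAlgebra.lift K ((UniversalEnvelopingAlgebra.ι K).comp 𝔥.incl)

/-- `U(𝔥)` as a subalgebra of `U(𝔤)`. -/
def envSub (𝔥 : LieSubalgebra K L) : Subalgebra K (UniversalEnvelopingAlgebra K L) :=
  (envIncl 𝔥).range

/-- The submodule of `U(𝔤) ⊗ W` generated by all `u a ⊗ w - u ⊗ a w` with `u ∈ U(𝔤)`,
`a ∈ U(𝔥)`, `w ∈ W`. -/
def indRel (𝔥 : LieSubalgebra K L) {W : Type*} [AddCommGroup W] [Module K W]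
    (ρ : 𝔥 →ₗ⁅K⁆ Module.End K W) :
    Submodule (UniversalEnvelopingAlgebra K L) (UniversalEnvelopingAlgebra K L ⊗[K] W) :=
  Submodule.span _ {z | ∃ (u : UniversalEnvelopingAlgebra K L)
    (a : UniversalEnvelopingAlgebra K 𝔥) (w : W),
    z = (u * envIncl 𝔥 a) ⊗ₜ[K] w - u ⊗ₜ[K] (UniversalEnvelopingAlgebra.lift K ρ a w)}

/-- The induced `U(𝔤)`-module `ind(W, 𝔤) = U(𝔤) ⊗_{U(𝔥)} W`, for a representation `ρ` of the
subalgebra `𝔥` in `W`. -/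
abbrev Ind (𝔥 : LieSubalgebra K L) {W : Type*} [AddCommGroup W] [Module K W]
    (ρ : 𝔥 →ₗ⁅K⁆ Module.End K W) :=
  (UniversalEnvelopingAlgebra K L ⊗[K] W) ⧸ indRel 𝔥 ρ

/-- The one-dimensional representation, in `K`, given by a character of a Lie algebra. -/
def charRep {H : Type*} [LieRing H] [LieAlgebra K H] (χ : LieAlgebra.LieCharacter K H) :
    H →ₗ⁅K⁆ Module.End K K :=
  (Algebra.lmul K K : K →ₗ⁅K⁆ Module.End K K).comp χ

end Induced

section Vergne

variable {K : Type u} [Field K] {L : Type v} [LieRing L] [LieAlgebra K L] {k : ℕ}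

/-- For an ideal `I` of `𝔤`, the stabilizer in `I` of the restriction of `f` to `I`:
all `x ∈ I` with `f([x, I]) = 0`. -/
def stabilizer (f : Module.Dual K L) (I : LieIdeal K L) : Submodule K L where
  carrier := {x | x ∈ I ∧ ∀ y ∈ I, f ⁅x, y⁆ = 0}
  zero_mem' := ⟨I.zero_mem, by simp⟩
  add_mem' := by
    rintro a b ⟨ha, ha'⟩ ⟨hb, hb'⟩
    exact ⟨I.add_mem ha hb, fun y hy => by simp [ha' y hy, hb' y hy]⟩
  smul_mem' := by
    rintro c a ⟨ha, ha'⟩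
    exact ⟨I.smul_mem c ha, fun y hy => by simp [ha' y hy]⟩

theorem stabilizer_lie {f : Module.Dual K L} {I J : LieIdeal K L} (h : J ≤ I) {x y : L}
    (hx : x ∈ stabilizer f I) (hy : y ∈ stabilizer f J) :
    f ⁅x, y⁆ = 0 ∧ ⁅x, y⁆ ∈ stabilizer f J := by
  refine ⟨hx.2 y (h hy.1), lie_mem_right K L J x y hy.1, fun z hz => ?_⟩
  rw [lie_lie, map_sub, hx.2 _ (h (lie_mem_right K L J y z hz)),
    hy.2 _ (lie_mem_right K L J x z hz), sub_zero]

theorem vergne_lie (s : Filtration K L k) (f : Module.Dual K L) {x y : L}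
    (hx : x ∈ ⨆ i, stabilizer f (s.ideal i)) (hy : y ∈ ⨆ i, stabilizer f (s.ideal i)) :
    f ⁅x, y⁆ = 0 ∧ ⁅x, y⁆ ∈ ⨆ i, stabilizer f (s.ideal i) := by
  induction hx using Submodule.iSup_induction' with
  | zero => simp
  | add a b _ _ ha hb =>
    rw [add_lie, map_add, ha.1, hb.1, add_zero]
    exact ⟨rfl, Submodule.add_mem _ ha.2 hb.2⟩
  | mem i a ha =>
    induction hy using Submodule.iSup_induction' with
    | zero => simp
    | add b c _ _ hb hc =>
      rw [lie_add, map_add, hb.1, hc.1, add_zero]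
      exact ⟨rfl, Submodule.add_mem _ hb.2 hc.2⟩
    | mem j b hb =>
      rcases le_total i j with hij | hij
      · have h := stabilizer_lie (s.antitone hij) ha hb
        exact ⟨h.1, Submodule.mem_iSup_of_mem j h.2⟩
      · have h := stabilizer_lie (s.antitone hij) hb ha
        rw [← lie_skew, map_neg, h.1, neg_zero]
        exact ⟨rfl, Submodule.neg_mem _ (Submodule.mem_iSup_of_mem i h.2)⟩

/-- The Vergne polarization `𝔭𝔳(f) = ∑ᵢ 𝔤ᵢ^{fᵢ}`, where `fᵢ` is the restriction of `f` to `𝔤ᵢ`. -/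
def pv (s : Filtration K L k) (f : Module.Dual K L) : LieSubalgebra K L where
  toSubmodule := ⨆ i, stabilizer f (s.ideal i)
  lie_mem' := fun hx hy => (vergne_lie s f hx hy).2

/-- The restriction of `f` to its Vergne polarization, as a character. -/
def pvChar (s : Filtration K L k) (f : Module.Dual K L) :
    LieAlgebra.LieCharacter K (pv s f) where
  toLinearMap := f.domRestrict (pv s f).toSubmodule
  map_lie' := by
    rintro ⟨x, hx⟩ ⟨y, hy⟩
    rw [LieRing.of_associative_ring_bracket, mul_comm, sub_self]
    exact (vergne_lie s f hx hy).1

/-- The `U(𝔤)`-module `M(f)` induced from the restriction of `f` to `𝔭𝔳(f)`. -/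
abbrev M (s : Filtration K L k) (f : Module.Dual K L) :=
  Ind (pv s f) (charRep (pvChar s f))

/-- The canonical generator `l = 1 ⊗ 1` of `M(f)`. -/
def gen (s : Filtration K L k) (f : Module.Dual K L) : M s f :=
  (indRel (pv s f) (charRep (pvChar s f))).mkQ (1 ⊗ₜ[K] (1 : K))

/-- The equivalence relation `ℜ` on `𝔤*`: the Vergne polarizations coincide and the two
functionals agree on this common polarization. -/
def relR (s : Filtration K L k) : Setoid (Module.Dual K L) where
  r f' f'' := pv s f' = pv s f'' ∧ ∀ x ∈ pv s f', f' x = f'' x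
  iseqv :=
    { refl := fun _ => ⟨rfl, fun _ _ => rfl⟩
      symm := fun h => ⟨h.1.symm, fun x hx => (h.2 x (h.1 ▸ hx)).symm⟩
      trans := fun h h' => ⟨h.1.trans h'.1,
        fun x hx => (h.2 x hx).trans (h'.2 x (h.1 ▸ hx))⟩ }

end Vergne

section Rep

variable {K : Type u} [Field K] {L : Type v} [LieRing L] [LieAlgebra K L] {k : ℕ}

/-- A representation of the filtered Lie algebra `(𝔤, s)`, i.e. a `U(𝔤, s)`-module: a
representation of `𝔤` in a vector space `V` with a chain of subspaces
`V = V₀ ⊇ V₁ ⊇ ⋯ ⊇ Vₖ` such that `Vᵢ` is invariant under `𝔤ᵢ`. -/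
structure FiltRep (s : Filtration K L k) where
  /-- the space `V` -/
  V : Type (max u v)
  [addCommGroup : AddCommGroup V]
  [module : Module K V]
  /-- the representation of `𝔤 = 𝔤₀` in `V = V₀` -/
  ρ : L →ₗ⁅K⁆ Module.End K V
  /-- the subspace `Vᵢ` -/
  fil : Fin (k + 1) → Submodule K V
  antitone : Antitone fil
  fil_zero : fil 0 = ⊤
  invariant : ∀ i, ∀ x ∈ s.ideal i, ∀ w ∈ fil i, ρ x w ∈ fil i

attribute [instance] FiltRep.addCommGroup FiltRep.module

variable {s : Filtration K L k}

/-- Equivalence of representations of `(𝔤, s)`: a linear isomorphism `C : V → W` with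
`C(Vᵢ) = Wᵢ` that intertwines the actions of `𝔤`. -/
def FiltRep.Equivalent (A B : FiltRep s) : Prop :=
  ∃ C : A.V ≃ₗ[K] B.V, (∀ i, (A.fil i).map (C : A.V →ₗ[K] B.V) = B.fil i) ∧
    ∀ (x : L) (w : A.V), C (A.ρ x w) = B.ρ x (C w)

/-- A representation of `(𝔤, s)` is irreducible if every `Vᵢ` is an irreducible representation
of `𝔤ᵢ`. -/
def FiltRep.IsIrreducible (A : FiltRep s) : Prop :=
  ∀ i, A.fil i ≠ ⊥ ∧ ∀ W : Submodule K A.V, W ≤ A.fil i →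
    (∀ x ∈ s.ideal i, ∀ w ∈ W, A.ρ x w ∈ W) → W = ⊥ ∨ W = A.fil i

/-- Equivalence, as an equivalence relation on irreducible representations of `(𝔤, s)`. -/
def irrSetoid (s : Filtration K L k) : Setoid {A : FiltRep s // A.IsIrreducible} where
  r A B := A.1.Equivalent B.1
  iseqv :=
    { refl := fun A => ⟨LinearEquiv.refl K _, fun i => Submodule.map_id _, fun _ _ => rfl⟩
      symm := by
        rintro A B ⟨C, h, h'⟩
        refine ⟨C.symm, fun i => ?_, fun x w => ?_⟩
        · rw [← h i, ← Submodule.map_comp]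
          simp
        · rw [LinearEquiv.symm_apply_eq, h', LinearEquiv.apply_symm_apply]
      trans := by
        rintro A B D ⟨C, h, h'⟩ ⟨C', g, g'⟩
        refine ⟨C.trans C', fun i => ?_, fun x w => ?_⟩
        · rw [← g i, ← h i, ← Submodule.map_comp]
          rfl
        · simp [h', g'] }

/-- `Irr(𝔤, s)`: the set of equivalence classes of irreducible representations of `(𝔤, s)`. -/
def Irr (s : Filtration K L k) := Quotient (irrSetoid s)

/-- The class in `Irr(𝔤, s)` of an irreducible representation. -/
def Irr.mk (A : FiltRep s) (h : A.IsIrreducible) : Irr s := Quotient.mk (irrSetoid s) ⟨A, h⟩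

end Rep

section Ms

variable {K : Type u} [Field K] {L : Type v} [LieRing L] [LieAlgebra K L] {k : ℕ}

/-- The subspace `Mᵢ(fᵢ)` of `M(f)`, that is, the image `U(𝔤ᵢ) l` of the canonical map from
`U(𝔤ᵢ) ⊗_{U(𝔭𝔳(f) ∩ 𝔤ᵢ)} K` to `M(f)`. -/
def Mfil (s : Filtration K L k) (f : Module.Dual K L) (i : Fin (k + 1)) : Submodule K (M s f) :=
  (Subalgebra.toSubmodule (envSub (s.ideal i).toLieSubalgebra)).map
    ((LinearMap.toSpanSingleton (UniversalEnvelopingAlgebra K L) (M s f)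
      (gen s f)).restrictScalars K)

theorem ι_mem_envSub {𝔥 : LieSubalgebra K L} {x : L} (hx : x ∈ 𝔥) :
    UniversalEnvelopingAlgebra.ι K x ∈ envSub 𝔥 :=
  ⟨UniversalEnvelopingAlgebra.ι K ⟨x, hx⟩, by
    simp only [envIncl, AlgHom.toRingHom_eq_coe, RingHom.coe_coe,
      UniversalEnvelopingAlgebra.lift_ι_apply]
    rfl⟩

theorem envSub_mono {𝔥 𝔥' : LieSubalgebra K L} (h : 𝔥 ≤ 𝔥') : envSub 𝔥 ≤ envSub 𝔥' := by
  have key : envIncl 𝔥 = (envIncl 𝔥').comp (UniversalEnvelopingAlgebra.lift K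
      ((UniversalEnvelopingAlgebra.ι K).comp (LieSubalgebra.inclusion h))) := by
    apply UniversalEnvelopingAlgebra.hom_ext
    ext x
    simp only [LieHom.comp_apply, AlgHom.coe_toLieHom, AlgHom.comp_apply, envIncl,
      UniversalEnvelopingAlgebra.lift_ι_apply]
    rfl
  rintro _ ⟨a, rfl⟩
  rw [key]
  exact ⟨_, rfl⟩

theorem envSub_top : envSub (⊤ : LieSubalgebra K L) = ⊤ := by
  have key : (envIncl (⊤ : LieSubalgebra K L)).comp (UniversalEnvelopingAlgebra.lift K
      ((UniversalEnvelopingAlgebra.ι K).comp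
        (LieSubalgebra.topEquiv (R := K) (L := L)).symm.toLieHom)) = AlgHom.id K _ := by
    apply UniversalEnvelopingAlgebra.hom_ext
    ext x
    simp only [LieHom.comp_apply, AlgHom.coe_toLieHom, AlgHom.comp_apply, envIncl,
      UniversalEnvelopingAlgebra.lift_ι_apply]
    rfl
  rw [eq_top_iff]
  intro u _
  exact ⟨_, DFunLike.congr_fun key u⟩

theorem gen_generates (s : Filtration K L k) (f : Module.Dual K L) (m : M s f) :
    ∃ u : UniversalEnvelopingAlgebra K L, u • gen s f = m := by
  obtain ⟨t, rfl⟩ := Submodule.mkQ_surjective _ m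
  induction t with
  | zero => exact ⟨0, by simp⟩
  | add a b ha hb =>
    obtain ⟨u, hu⟩ := ha
    obtain ⟨w, hw⟩ := hb
    exact ⟨u + w, by rw [add_smul, hu, hw, map_add]⟩
  | tmul u c =>
    refine ⟨c • u, ?_⟩
    rw [gen, ← map_smul, TensorProduct.smul_tmul', smul_eq_mul, mul_one, TensorProduct.smul_tmul,
      smul_eq_mul, mul_one]

/-- The `U(𝔤, s)`-module `M_s(f)`: the module `M(f)` with the filtration
`M(f) = M₀(f₀) ⊇ M₁(f₁) ⊇ ⋯ ⊇ Mₖ(fₖ)`. -/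
def Ms (s : Filtration K L k) (f : Module.Dual K L) : FiltRep s where
  V := M s f
  ρ := AlgHom.toLieHom (Algebra.lsmul K K (M s f) :
    UniversalEnvelopingAlgebra K L →ₐ[K] Module.End K (M s f)) |>.comp
      (UniversalEnvelopingAlgebra.ι K)
  fil := Mfil s f
  antitone := fun _ _ hij => Submodule.map_mono (envSub_mono (s.antitone hij))
  fil_zero := by
    rw [eq_top_iff]
    intro m _
    obtain ⟨u, rfl⟩ := gen_generates s f m
    refine ⟨u, ?_, rfl⟩
    have h : (s.ideal 0).toLieSubalgebra = ⊤ := by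
      rw [s.ideal_zero]
      rfl
    rw [h, envSub_top]
    trivial
  invariant := by
    rintro i x hx _ ⟨u, hu, rfl⟩
    refine ⟨UniversalEnvelopingAlgebra.ι K x * u, (envSub _).mul_mem (ι_mem_envSub hx) hu, ?_⟩
    exact mul_smul (UniversalEnvelopingAlgebra.ι K x) u (gen s f)

end Ms

end FiltLie

end

/-! Everything rests on descending induction along the filtration, applied to an arbitrary module
with a nonzero vector `l` on which `𝔭𝔳(fᵢ)` acts through `f`. At each step put `H = 𝔤ᵢ₊₁`, `G = 𝔤ᵢ =
K z + H`; there are two cases (`stabilizer_dichotomy`). If `z` can be chosen in the stabilizer of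
`f` on `G`, then `z` joins the polarization, acts on `l` by a scalar, and `U(G) l = U(H) l`.
Otherwise the polarization does not change, and some `y` stabilizing `f` on `H` has `f([z, y]) ≠ 0`.
Then no operator of `V₁ = U(H) l` implements `ad z`, and `U(G) l` is filtered by the sums `∑_{j<n}
zʲ V₁`. The commutator of `y` with `zⁿ⁺¹` has second-order term `-(n + 1) zⁿ [z, y]`; in
characteristic zero this makes `V₁` essential in `U(G) l` as an `H`-module. The induction
(`isGood_pvFrom`) carries four properties: irreducibility; elements preserving `K l` lie in the
polarization; eigenvectors of the polarization with eigenvalue `f` are multiples of `l`; and a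
condition for `ad x` to be implemented on the module.

Injectivity: every nonzero `𝔤ᵢ₊₁`-submodule of `U(𝔤ᵢ) l` contains `l`. Hence two such generators of
one module generate the same `𝔤ᵢ`-modules for all `i`, and finally the same line. That line
determines the polarization and `f` on it. For this to apply to `M(f)`, `l ≠ 0` is needed; it
follows by mapping `M(f)` to an explicitly constructed module (`exists_model`).

Surjectivity over an algebraically closed field: a nonzero `l` in `Vₖ` is shown to be an eigenvector
of `𝔭𝔳(f)` for an `f` built from the bottom of the filtration up (`exists_dual_isEig`). The
universal property gives a map from `M(f)`, bijective by irreducibility. -/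

open scoped TensorProduct

universe w

noncomputable section

namespace FiltLie

/-! ### Invariant subspaces and the submodules they generate -/

section Stable

variable {K : Type u} [Field K] {L : Type v} [LieRing L] [LieAlgebra K L]
  {V : Type w} [AddCommGroup V] [Module K V]

/-- The linear map `ρ` restricts to a representation of the ideal `I`. -/
def IsRepOn (ρ : L →ₗ[K] Module.End K V) (I : LieIdeal K L) : Prop :=
  ∀ x ∈ I, ∀ y ∈ I, ∀ v, ρ ⁅x, y⁆ v = ρ x (ρ y v) - ρ y (ρ x v)

/-- The subspace `W` is invariant under `ρ(I)`. -/
def Stable (ρ : L →ₗ[K] Module.End K V) (I : LieIdeal K L) (W : Submodule K V) : Prop :=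
  ∀ x ∈ I, ∀ w ∈ W, ρ x w ∈ W

/-- The smallest `ρ(I)`-invariant subspace containing `S`. -/
def cyc (ρ : L →ₗ[K] Module.End K V) (I : LieIdeal K L) (S : Submodule K V) : Submodule K V :=
  sInf {W | S ≤ W ∧ Stable ρ I W}

/-- The vector `l` is a common eigenvector of `ρ(p)` with eigenvalue `f`. -/
def IsEig (f : Module.Dual K L) (ρ : L →ₗ[K] Module.End K V) (p : Submodule K L) (l : V) : Prop :=
  ∀ y ∈ p, ρ y l = f y • l

variable {ρ : L →ₗ[K] Module.End K V} {G H : LieIdeal K L} {f : Module.Dual K L}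

theorem IsRepOn.mono (h : IsRepOn ρ G) (hle : H ≤ G) : IsRepOn ρ H :=
  fun x hx y hy => h x (hle hx) y (hle hy)

theorem Stable.mono {W : Submodule K V} (h : Stable ρ G W) (hle : H ≤ G) : Stable ρ H W :=
  fun x hx => h x (hle hx)

theorem Stable.inf {W W' : Submodule K V} (h : Stable ρ G W) (h' : Stable ρ G W') :
    Stable ρ G (W ⊓ W') :=
  fun x hx w hw => ⟨h x hx w hw.1, h' x hx w hw.2⟩

theorem Stable.sup {W W' : Submodule K V} (h : Stable ρ G W) (h' : Stable ρ G W') :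
    Stable ρ G (W ⊔ W') := by
  intro x hx w hw
  obtain ⟨a, ha, b, hb, rfl⟩ := Submodule.mem_sup.1 hw
  rw [map_add]
  exact Submodule.add_mem_sup (h x hx a ha) (h' x hx b hb)

theorem Stable.bot : Stable ρ G (⊥ : Submodule K V) := by
  intro x _ w hw
  rw [Submodule.mem_bot] at hw ⊢
  rw [hw, map_zero]

theorem le_cyc (S : Submodule K V) : S ≤ cyc ρ G S :=
  le_sInf fun _ h => h.1

theorem stable_cyc (S : Submodule K V) : Stable ρ G (cyc ρ G S) := by
  intro x hx w hw
  rw [cyc, Submodule.mem_sInf] at hw ⊢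
  exact fun W hW => hW.2 x hx w (hw W hW)

theorem cyc_le {S W : Submodule K V} (h : S ≤ W) (hW : Stable ρ G W) : cyc ρ G S ≤ W :=
  sInf_le ⟨h, hW⟩

theorem cyc_mono {S S' : Submodule K V} (h : S ≤ S') : cyc ρ G S ≤ cyc ρ G S' :=
  cyc_le (h.trans (le_cyc S')) (stable_cyc S')

theorem cyc_mono_ideal (hle : H ≤ G) (S : Submodule K V) : cyc ρ H S ≤ cyc ρ G S :=
  cyc_le (le_cyc S) ((stable_cyc S).mono hle)

theorem mem_cyc_self (l : V) : l ∈ cyc ρ G (K ∙ l) :=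
  le_cyc _ (Submodule.mem_span_singleton_self l)

theorem cyc_span_le {l : V} {W : Submodule K V} (h : l ∈ W) (hW : Stable ρ G W) :
    cyc ρ G (K ∙ l) ≤ W :=
  cyc_le ((Submodule.span_singleton_le_iff_mem l W).2 h) hW

/-- If `T` acts on a subspace as a twisted derivation and maps the generators into `W`, it maps
everything into `W`. -/
theorem map_cyc_le {S W : Submodule K V} {T : Module.End K V} (hW : Stable ρ G W)
    (hS : ∀ v ∈ S, T v ∈ W)
    (hT : ∀ y ∈ G, ∀ v ∈ cyc ρ G S, T (ρ y v) - ρ y (T v) ∈ W) :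
    ∀ v ∈ cyc ρ G S, T v ∈ W := by
  have : cyc ρ G S ≤ cyc ρ G S ⊓ W.comap T := by
    refine cyc_le (le_inf (le_cyc S) hS) fun y hy v hv => ⟨stable_cyc S y hy v hv.1, ?_⟩
    have := W.add_mem (hT y hy v hv.1) (hW y hy _ hv.2)
    simpa using this
  exact fun v hv => (this hv).2

/-- If `ρ(z)` maps the generators into the `H`-module they generate, this is also the module they
generate over `G = K z + H`. -/
theorem cyc_eq_of_codim {S : Submodule K V} {z : L} (hρ : IsRepOn ρ G) (hle : H ≤ G) (hz : z ∈ G)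
    (hG : ∀ x ∈ G, ∃ c : K, x - c • z ∈ H) (hS : ∀ v ∈ S, ρ z v ∈ cyc ρ H S) :
    cyc ρ G S = cyc ρ H S := by
  refine le_antisymm (cyc_le (le_cyc S) fun x hx v hv => ?_) (cyc_mono_ideal hle S)
  obtain ⟨c, hc⟩ := hG x hx
  have h1 : ρ z v ∈ cyc ρ H S := by
    refine map_cyc_le (stable_cyc S) hS (fun y hy v hv => ?_) v hv
    rw [← hρ z hz y (hle hy)]
    exact stable_cyc S _ (lie_mem_right K L H z y hy) v hv
  have h2 := (cyc ρ H S).add_mem (stable_cyc S _ hc v hv) ((cyc ρ H S).smul_mem c h1)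
  simpa using h2

/-- A linear choice of preimages modulo `F`. -/
theorem exists_linear_select {V1 P F : Submodule K V} (a b : Module.End K V)
    (h : ∀ v ∈ V1, ∃ t ∈ P, a v - b t ∈ F) (hb : ∀ t ∈ P, b t ∈ F → t = 0) :
    ∃ T : Module.End K V, ∀ v ∈ V1, T v ∈ P ∧ a v - b (T v) ∈ F := by
  -- The vector `t` given by `h` is unique because `b` is injective modulo `F` on `P`; a left
  -- inverse of `B` selects it linearly.
  let B : P →ₗ[K] V ⧸ F := (F.mkQ ∘ₗ b).domRestrict P
  have hB : Function.Injective B := by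
    rw [← LinearMap.ker_eq_bot, LinearMap.ker_eq_bot']
    intro m hm
    exact Subtype.ext (hb m m.2 ((Submodule.Quotient.mk_eq_zero F).1 hm))
  obtain ⟨g, hg⟩ := B.exists_leftInverse_of_injective (LinearMap.ker_eq_bot.2 hB)
  refine ⟨P.subtype ∘ₗ g ∘ₗ F.mkQ ∘ₗ a, fun v hv => ⟨(g _).2, ?_⟩⟩
  obtain ⟨t, ht, hat⟩ := h v hv
  have h1 : F.mkQ (a v) = B ⟨t, ht⟩ := (Submodule.Quotient.eq F).2 hat
  have h2 : g (F.mkQ (a v)) = ⟨t, ht⟩ := by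
    rw [h1]
    exact DFunLike.congr_fun hg _
  change a v - b (g (F.mkQ (a v)) : V) ∈ F
  rwa [h2]

end Stable

/-! ### Modules filtered by powers of an operator that normalizes the action of an ideal -/

section Tower

variable {K : Type u} [Field K] {L : Type v} [LieRing L] [LieAlgebra K L]
  {V : Type w} [AddCommGroup V] [Module K V]

/-- The subspace `∑_{j < n} Zʲ V₁`. -/
def tower (Z : Module.End K V) (V1 : Submodule K V) : ℕ → Submodule K V
  | 0 => ⊥
  | n + 1 => tower Z V1 n ⊔ V1.map (Z ^ n)

/-- The element `z` normalizes the action of `H`, and `V₁` is `H`-invariant. -/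
structure IsTower (ρ : L →ₗ[K] Module.End K V) (H : LieIdeal K L) (z : L)
    (V1 : Submodule K V) : Prop where
  comm : ∀ y ∈ H, ∀ v, ρ y (ρ z v) = ρ z (ρ y v) - ρ ⁅z, y⁆ v
  stable : Stable ρ H V1

/-- The derivation `ad x` of `H` is not implemented by an operator on `V₁`. -/
def NoExt (ρ : L →ₗ[K] Module.End K V) (H : LieIdeal K L) (x : L) (V1 : Submodule K V) : Prop :=
  ∀ T : Module.End K V, (∀ v ∈ V1, T v ∈ V1) →
    ¬ ∀ y ∈ H, ∀ v ∈ V1, T (ρ y v) - ρ y (T v) = ρ ⁅x, y⁆ v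

variable {ρ : L →ₗ[K] Module.End K V} {H : LieIdeal K L} {z : L} {V1 : Submodule K V}

theorem tower_mono (Z : Module.End K V) : Monotone (tower Z V1) :=
  monotone_nat_of_le_succ fun _ => le_sup_left

theorem tower_one (Z : Module.End K V) : tower Z V1 1 = V1 := by
  rw [tower, tower, pow_zero, bot_sup_eq]
  exact Submodule.map_id V1

theorem pow_mem_tower (Z : Module.End K V) {v : V} (hv : v ∈ V1) (n : ℕ) :
    (Z ^ n) v ∈ tower Z V1 (n + 1) :=
  Submodule.mem_sup_right (Submodule.mem_map_of_mem hv)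

theorem apply_mem_tower (Z : Module.End K V) {n : ℕ} {v : V} (hv : v ∈ tower Z V1 n) :
    Z v ∈ tower Z V1 (n + 1) := by
  induction n generalizing v with
  | zero =>
    rw [tower, Submodule.mem_bot] at hv
    rw [hv, map_zero]
    exact zero_mem _
  | succ n ih =>
    obtain ⟨a, ha, _, ⟨b, hb, rfl⟩, rfl⟩ := Submodule.mem_sup.1 hv
    rw [map_add]
    refine add_mem (tower_mono Z (Nat.le_succ _) (ih ha)) ?_
    rw [← Module.End.mul_apply, ← pow_succ']
    exact pow_mem_tower Z hb (n + 1)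

namespace IsTower

/-- The two claims feed each other: the commutator with `zⁿ` gives invariance at level `n + 1`,
which in turn controls the term `[z, y] zⁿ` in the commutator with `zⁿ⁺¹`. -/
theorem comm_pow_mem (h : IsTower ρ H z V1) (n : ℕ) :
    Stable ρ H (tower (ρ z) V1 n) ∧ ∀ y ∈ H, ∀ v ∈ V1,
      ρ y ((ρ z ^ n) v) - (ρ z ^ n) (ρ y v) ∈ tower (ρ z) V1 n := by
  induction n with
  | zero => exact ⟨Stable.bot, fun y _ v _ => by simp⟩
  | succ n ih =>
    have key : Stable ρ H (tower (ρ z) V1 (n + 1)) := by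
      intro y hy w hw
      obtain ⟨a, ha, _, ⟨b, hb, rfl⟩, rfl⟩ := Submodule.mem_sup.1 hw
      rw [map_add]
      refine add_mem (tower_mono _ (Nat.le_succ _) (ih.1 y hy a ha)) ?_
      have := add_mem (tower_mono _ (Nat.le_succ _) (ih.2 y hy b hb))
        (pow_mem_tower (ρ z) (h.stable y hy b hb) n)
      simpa using this
    refine ⟨key, fun y hy v hv => ?_⟩
    have h1 := apply_mem_tower _ (ih.2 y hy v hv)
    have h2 := key _ (lie_mem_right K L H z y hy) _ (pow_mem_tower (ρ z) hv n)
    have := sub_mem h1 h2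
    rw [pow_succ', Module.End.mul_apply, Module.End.mul_apply, h.comm y hy]
    rw [map_sub] at this
    convert this using 1
    abel

theorem stable_tower (h : IsTower ρ H z V1) (n : ℕ) : Stable ρ H (tower (ρ z) V1 n) :=
  (h.comm_pow_mem n).1

theorem comm_mem (h : IsTower ρ H z V1) (n : ℕ) {y : L} (hy : y ∈ H) {v : V} (hv : v ∈ V1) :
    ρ y ((ρ z ^ n) v) - (ρ z ^ n) (ρ y v) ∈ tower (ρ z) V1 n :=
  (h.comm_pow_mem n).2 y hy v hv

/-- Each of the `n + 1` factors `z` passed by `y` contributes one `-zⁿ [z, y]`. The coefficient `n +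
1` is where characteristic zero acts. -/
theorem comm_succ_mem (h : IsTower ρ H z V1) (n : ℕ) {y : L} (hy : y ∈ H) {v : V} (hv : v ∈ V1) :
    ρ y ((ρ z ^ (n + 1)) v) - (ρ z ^ (n + 1)) (ρ y v) + ((n : K) + 1) • (ρ z ^ n) (ρ ⁅z, y⁆ v)
      ∈ tower (ρ z) V1 n := by
  induction n with
  | zero => simp [h.comm y hy]
  | succ n ih =>
    have h1 := apply_mem_tower _ ih
    have h2 := h.comm_mem (n + 1) (lie_mem_right K L H z y hy) hv
    have := sub_mem h1 h2
    rw [map_add, map_sub, map_smul, ← Module.End.mul_apply (ρ z) (ρ z ^ n), ← pow_succ',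
      ← Module.End.mul_apply (ρ z) (ρ z ^ (n + 1)) (ρ y v), ← pow_succ'] at this
    rw [pow_succ' (ρ z) (n + 1), Module.End.mul_apply, h.comm y hy, ← pow_succ' (ρ z) (n + 1)]
    convert this using 1
    push_cast
    module

/-- A map that is `H`-equivariant modulo lower terms cannot have a leading term of positive
degree. -/
theorem no_leading_term [CharZero K] (h : IsTower ρ H z V1) (hne : NoExt ρ H z V1) {m : ℕ}
    (hdir : ∀ v ∈ V1, (ρ z ^ m) v ∈ tower (ρ z) V1 m → v = 0) {c : K} (hc : c ≠ 0)
    (A : Module.End K V)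
    (hA : ∀ v ∈ V1, A v - c • (ρ z ^ (m + 1)) v ∈ tower (ρ z) V1 (m + 1))
    (hAy : ∀ y ∈ H, ∀ v ∈ V1, A (ρ y v) - ρ y (A v) ∈ tower (ρ z) V1 m) : False := by
  -- `T` is the next coefficient: `A v ≡ c zᵐ⁺¹ v + zᵐ T v` modulo `tower m`.
  obtain ⟨T, hT⟩ := exists_linear_select (V1 := V1) (P := V1) (F := tower (ρ z) V1 m)
    (A - c • ρ z ^ (m + 1)) (ρ z ^ m) (fun v hv => by
      obtain ⟨a, ha, _, ⟨b, hb, rfl⟩, hab⟩ := Submodule.mem_sup.1 (hA v hv)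
      refine ⟨b, hb, ?_⟩
      rw [LinearMap.sub_apply, LinearMap.smul_apply, ← hab]
      simpa using ha) hdir
  have hm : ((m : K) + 1) ≠ 0 := by exact_mod_cast Nat.succ_ne_zero m
  -- This compares the coefficients of `zᵐ` in `[A, y] ≡ 0`. After division by `-c (m + 1)`, `T`
  -- implements `ad z` on `V₁`.
  have key : ∀ y ∈ H, ∀ v ∈ V1,
      T (ρ y v) - ρ y (T v) + (c * ((m : K) + 1)) • ρ ⁅z, y⁆ v = 0 := by
    intro y hy v hv
    have hyv := h.stable y hy v hv
    have hzy := lie_mem_right K L H z y hy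
    refine hdir _ (add_mem (sub_mem (hT _ hyv).1 (h.stable y hy _ (hT v hv).1))
      (V1.smul_mem _ (h.stable _ hzy v hv))) ?_
    have e1 := (hT _ hyv).2
    have e2 := h.stable_tower m y hy _ (hT v hv).2
    have e3 := h.comm_mem m hy (hT v hv).1
    have e4 := Submodule.smul_mem _ c (h.comm_succ_mem m hy hv)
    have e5 := hAy y hy v hv
    have := add_mem (add_mem (add_mem (sub_mem e2 e1) e3) e4) e5
    simp only [LinearMap.sub_apply, LinearMap.smul_apply, map_sub, map_smul] at this
    simp only [map_sub, map_add, map_smul]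
    convert this using 1
    module
  refine hne (-(c * ((m : K) + 1))⁻¹ • T) (fun v hv => V1.smul_mem _ (hT v hv).1)
    fun y hy v hv => ?_
  have hk := key y hy v hv
  have hcm : c * ((m : K) + 1) ≠ 0 := mul_ne_zero hc hm
  have : T (ρ y v) - ρ y (T v) = -((c * ((m : K) + 1)) • ρ ⁅z, y⁆ v) :=
    eq_neg_of_add_eq_zero_left hk
  rw [LinearMap.smul_apply, LinearMap.smul_apply, map_smul, ← smul_sub, this, neg_smul, smul_neg,
    neg_neg, inv_smul_smul₀ hcm]

/-- If the conclusion fails for one `v ≠ 0`, irreducibility spreads the failure to all of `V₁`. The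
component in `N` is then an operator `A` with leading term `zⁿ⁺¹`. Its commutators with `H` lie in
both `N` and the tower, so they vanish, which `no_leading_term` forbids. -/
theorem eq_zero_of_pow_mem_sup_of_injective [CharZero K] (h : IsTower ρ H z V1)
    (hne : NoExt ρ H z V1)
    (hirr : ∀ W, Stable ρ H W → W ≤ V1 → W ≠ ⊥ → V1 ≤ W) (n : ℕ)
    (hdir : ∀ v ∈ V1, (ρ z ^ n) v ∈ tower (ρ z) V1 n → v = 0)
    (N : Submodule K V) (hN : Stable ρ H N) (hb : N ⊓ tower (ρ z) V1 (n + 1) = ⊥) :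
      ∀ v ∈ V1, (ρ z ^ (n + 1)) v ∈ N ⊔ tower (ρ z) V1 (n + 1) → v = 0 := by
  by_contra! hcon
  obtain ⟨v, hv, hzv, hv0⟩ := hcon
  have hst := h.stable_tower (n + 1)
  have hR : V1 ≤ V1 ⊓ (N ⊔ tower (ρ z) V1 (n + 1)).comap (ρ z ^ (n + 1)) := by
    refine hirr _ (fun y hy w hw => ⟨h.stable y hy w hw.1, ?_⟩) inf_le_left
      fun h0 => hv0 ((Submodule.mem_bot K).1 (h0 ▸ ⟨hv, hzv⟩))
    have := sub_mem ((hN.sup hst) y hy _ hw.2)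
      (Submodule.mem_sup_right (S := N) (h.comm_mem (n + 1) hy hw.1))
    simpa using this
  obtain ⟨A, hA⟩ := exists_linear_select (V1 := V1) (P := N) (F := tower (ρ z) V1 (n + 1))
    (ρ z ^ (n + 1)) 1 (fun v hv => by
      obtain ⟨a, ha, b, hb, hab⟩ := Submodule.mem_sup.1 (hR hv).2
      refine ⟨a, ha, ?_⟩
      rw [← hab]
      simpa using hb) (fun t ht ht' => (Submodule.mem_bot K).1 (hb ▸ ⟨ht, ht'⟩))
  refine h.no_leading_term hne hdir one_ne_zero A (fun v hv => ?_) fun y hy v hv => ?_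
  · have := neg_mem (hA v hv).2
    simpa using this
  · have hyv := h.stable y hy v hv
    have hmem : A (ρ y v) - ρ y (A v) ∈ tower (ρ z) V1 (n + 1) := by
      have e1 := (hA _ hyv).2
      have e2 := hst y hy _ (hA v hv).2
      have e3 := h.comm_mem (n + 1) hy hv
      have := sub_mem (sub_mem e2 e1) e3
      simp only [Module.End.one_apply, map_sub] at this
      convert this using 1
      abel
    have h0 : A (ρ y v) - ρ y (A v) = 0 := (Submodule.mem_bot K).1
      (hb ▸ ⟨sub_mem (hA _ hyv).1 (hN y hy _ (hA v hv).1), hmem⟩)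
    rw [h0]
    exact zero_mem _

theorem eq_zero_of_pow_mem_sup [CharZero K] (h : IsTower ρ H z V1) (hne : NoExt ρ H z V1)
    (hirr : ∀ W, Stable ρ H W → W ≤ V1 → W ≠ ⊥ → V1 ≤ W) (n : ℕ) :
    ∀ N : Submodule K V, Stable ρ H N → N ⊓ tower (ρ z) V1 (n + 1) = ⊥ →
      ∀ v ∈ V1, (ρ z ^ (n + 1)) v ∈ N ⊔ tower (ρ z) V1 (n + 1) → v = 0 := by
  induction n with
  | zero =>
    exact h.eq_zero_of_pow_mem_sup_of_injective hne hirr 0 (by simp [tower])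
  | succ n ih =>
    exact h.eq_zero_of_pow_mem_sup_of_injective hne hirr (n + 1) fun v hv hzv =>
      ih ⊥ Stable.bot (bot_inf_eq _) v hv (by simpa using hzv)

theorem eq_zero_of_pow_mem_tower [CharZero K] (h : IsTower ρ H z V1) (hne : NoExt ρ H z V1)
    (hirr : ∀ W, Stable ρ H W → W ≤ V1 → W ≠ ⊥ → V1 ≤ W) (n : ℕ) :
    ∀ v ∈ V1, (ρ z ^ n) v ∈ tower (ρ z) V1 n → v = 0 := by
  cases n with
  | zero => simp [tower]
  | succ n =>
    exact fun v hv hzv => h.eq_zero_of_pow_mem_sup hne hirr n ⊥ Stable.bot (bot_inf_eq _) v hv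
      (by simpa using hzv)

/-- `V₁` is an essential `H`-submodule of `∑ zʲ V₁`. -/
theorem inf_ne_bot [CharZero K] (h : IsTower ρ H z V1) (hne : NoExt ρ H z V1)
    (hirr : ∀ W, Stable ρ H W → W ≤ V1 → W ≠ ⊥ → V1 ≤ W) (n : ℕ) :
    ∀ N : Submodule K V, Stable ρ H N → N ≤ tower (ρ z) V1 n → N ≠ ⊥ → N ⊓ V1 ≠ ⊥ := by
  induction n with
  | zero => exact fun N _ hN h0 => absurd (le_bot_iff.1 hN) h0
  | succ n ih =>
    intro N hN hle h0
    -- If `N` misses the lower level, the leading coefficients of its elements vanish by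
    -- `eq_zero_of_pow_mem_sup`, so `N = 0`. Otherwise the induction applies to the intersection.
    by_cases hb : N ⊓ tower (ρ z) V1 n = ⊥
    · cases n with
      | zero =>
        rw [zero_add, tower_one] at hle
        rwa [inf_eq_left.2 hle]
      | succ m =>
        refine absurd ((Submodule.eq_bot_iff _).2 fun w hw => ?_) h0
        obtain ⟨a, ha, _, ⟨b, hb', rfl⟩, rfl⟩ := Submodule.mem_sup.1 (hle hw)
        have hb0 : b = 0 := by
          refine h.eq_zero_of_pow_mem_sup hne hirr m N hN hb b hb' ?_
          have := Submodule.sub_mem _ (Submodule.mem_sup_left hw)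
            (Submodule.mem_sup_right (S := N) ha)
          simpa using this
        rw [hb0, map_zero, add_zero] at hw ⊢
        exact (Submodule.mem_bot K).1 (hb ▸ ⟨hw, ha⟩)
    · have := ih _ (hN.inf (h.stable_tower n)) inf_le_right hb
      exact fun h' => this (le_bot_iff.1 (le_trans (inf_le_inf_right _ inf_le_left) h'.le))

/-- The commutators of `T` with `H` have degree zero, so the coefficient of `zⁿ⁺¹` in `T` commutes
with `H`; `hscal` makes it a scalar. -/
theorem exists_leading_coeff [CharZero K] (h : IsTower ρ H z V1) (hne : NoExt ρ H z V1)
    (hirr : ∀ W, Stable ρ H W → W ≤ V1 → W ≠ ⊥ → V1 ≤ W)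
    (hscal : ∀ S : Module.End K V, (∀ v ∈ V1, S v ∈ V1) →
      (∀ y ∈ H, ∀ v ∈ V1, S (ρ y v) = ρ y (S v)) → ∃ c : K, ∀ v ∈ V1, S v = c • v)
    {T : Module.End K V} (hT : ∀ y ∈ H, ∀ v ∈ V1, T (ρ y v) - ρ y (T v) ∈ V1) (n : ℕ)
    (hn : ∀ v ∈ V1, T v ∈ tower (ρ z) V1 (n + 2)) :
    ∃ c : K, ∀ v ∈ V1, T v - c • (ρ z ^ (n + 1)) v ∈ tower (ρ z) V1 (n + 1) := by
  have hdir := h.eq_zero_of_pow_mem_tower hne hirr (n + 1)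
  obtain ⟨S, hS⟩ := exists_linear_select (V1 := V1) (P := V1) (F := tower (ρ z) V1 (n + 1))
    T (ρ z ^ (n + 1)) (fun v hv => by
      obtain ⟨a, ha, _, ⟨b, hb, rfl⟩, hab⟩ := Submodule.mem_sup.1 (hn v hv)
      refine ⟨b, hb, ?_⟩
      rw [← hab]
      simpa using ha) hdir
  have hle : V1 ≤ tower (ρ z) V1 (n + 1) := by
    conv_lhs => rw [← tower_one (ρ z) (V1 := V1)]
    exact tower_mono _ (by omega)
  obtain ⟨c, hc⟩ := hscal S (fun v hv => (hS v hv).1) (fun y hy v hv => by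
    have hyv := h.stable y hy v hv
    refine sub_eq_zero.1 (hdir _ (sub_mem (hS _ hyv).1 (h.stable y hy _ (hS v hv).1)) ?_)
    have e1 := (hS _ hyv).2
    have e2 := h.stable_tower _ y hy _ (hS v hv).2
    have e3 := h.comm_mem (n + 1) hy (hS v hv).1
    have e4 := hle (hT y hy v hv)
    have := add_mem (add_mem (sub_mem e2 e1) e3) e4
    simp only [map_sub] at this ⊢
    convert this using 1
    abel)
  refine ⟨c, fun v hv => ?_⟩
  have := (hS v hv).2
  rwa [hc v hv, map_smul] at this

/-- An operator on `V₁` with values in `∑ zʲ V₁` that implements `ad x` on `H` implements, up to a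
multiple of `z`, an operator of `V₁`. -/
theorem exists_sub_smul_mem [CharZero K] (h : IsTower ρ H z V1) (hne : NoExt ρ H z V1)
    (hirr : ∀ W, Stable ρ H W → W ≤ V1 → W ≠ ⊥ → V1 ≤ W)
    (hscal : ∀ S : Module.End K V, (∀ v ∈ V1, S v ∈ V1) →
      (∀ y ∈ H, ∀ v ∈ V1, S (ρ y v) = ρ y (S v)) → ∃ c : K, ∀ v ∈ V1, S v = c • v)
    {T : Module.End K V} (hT : ∀ y ∈ H, ∀ v ∈ V1, T (ρ y v) - ρ y (T v) ∈ V1) (n : ℕ)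
    (hn : ∀ v ∈ V1, T v ∈ tower (ρ z) V1 (n + 2)) :
    ∃ c : K, ∀ v ∈ V1, T v - c • ρ z v ∈ V1 := by
  induction n with
  | zero =>
    obtain ⟨c, hc⟩ := h.exists_leading_coeff hne hirr hscal hT 0 hn
    refine ⟨c, fun v hv => ?_⟩
    simpa [tower_one] using hc v hv
  | succ n ih =>
    obtain ⟨c, hc⟩ := h.exists_leading_coeff hne hirr hscal hT (n + 1) hn
    have hle : V1 ≤ tower (ρ z) V1 (n + 1) := by
      conv_lhs => rw [← tower_one (ρ z) (V1 := V1)]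
      exact tower_mono _ (by omega)
    -- In degree at least two, commutators with values in `V₁` lie two levels below the leading
    -- term, so `no_leading_term` applies. In degree one they do not, which is why a multiple of `z`
    -- survives.
    have hc0 : c = 0 := by
      by_contra hc0
      exact h.no_leading_term hne (h.eq_zero_of_pow_mem_tower hne hirr (n + 1)) hc0 T hc
        fun y hy v hv => hle (hT y hy v hv)
    refine ih fun v hv => ?_
    simpa [hc0] using hc v hv

end IsTower

end Tower

/-! ### One step of the induction: from an ideal to an ideal one dimension larger -/

section Model

variable {K : Type u} [Field K] {L : Type v} [LieRing L] [LieAlgebra K L]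
  {V : Type w} [AddCommGroup V] [Module K V]

/-- The properties of the `G`-module generated by `l` that are carried along the filtration:
irreducibility, description of the normalizer of the line `K l` and of the eigenvectors, and
a criterion for the extension of the module to a larger Lie algebra. -/
structure IsGood (f : Module.Dual K L) (ρ : L →ₗ[K] Module.End K V) (G : LieIdeal K L)
    (p : Submodule K L) (l : V) : Prop where
  irr : ∀ W, Stable ρ G W → W ≤ cyc ρ G (K ∙ l) → W ≠ ⊥ → l ∈ W
  norm : ∀ x ∈ G, ρ x l ∈ K ∙ l → x ∈ p
  eig : ∀ v ∈ cyc ρ G (K ∙ l), IsEig f ρ p v → v ∈ K ∙ l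
  ext : ∀ (x : L) (T : Module.End K V), (∀ v ∈ cyc ρ G (K ∙ l), T v ∈ cyc ρ G (K ∙ l)) →
    (∀ y ∈ G, ∀ v ∈ cyc ρ G (K ∙ l), T (ρ y v) - ρ y (T v) = ρ ⁅x, y⁆ v) →
    ∃ x' ∈ G, ∀ y ∈ G, f ⁅x + x', y⁆ = 0

/-- The subspace `p` is contained in `H` and preserved by every element stabilizing `f` on `H`. -/
structure IsPol (f : Module.Dual K L) (H : LieIdeal K L) (p : Submodule K L) : Prop where
  le : ∀ y ∈ p, y ∈ H
  lie : ∀ a : L, (∀ y ∈ H, f ⁅a, y⁆ = 0) → ∀ y ∈ p, ⁅a, y⁆ ∈ p ∧ f ⁅a, y⁆ = 0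

variable {ρ : L →ₗ[K] Module.End K V} {G H : LieIdeal K L} {f : Module.Dual K L}
  {pG pH : Submodule K L} {z : L} {l : V}

theorem cyc_eq_of_stabilizer (hρ : IsRepOn ρ G) (hle : H ≤ G) (hz : z ∈ G)
    (hG : ∀ x ∈ G, ∃ c : K, x - c • z ∈ H) {c : K} (hl : ρ z l = c • l) :
    cyc ρ G (K ∙ l) = cyc ρ H (K ∙ l) := by
  refine cyc_eq_of_codim hρ hle hz hG fun v hv => ?_
  obtain ⟨a, rfl⟩ := Submodule.mem_span_singleton.1 hv
  rw [map_smul, hl]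
  exact Submodule.smul_mem _ _ (Submodule.smul_mem _ _ (mem_cyc_self l))

/-- As `z` acts on `l` by a scalar, the module is the same over `G` and over `H`. Irreducibility and
the eigenvector property are inherited; the other two need `z` to be split off. -/
theorem IsGood.of_stabilizer (hρ : IsRepOn ρ G) (hle : H ≤ G) (hz : z ∈ stabilizer f G)
    (hG : ∀ x ∈ G, ∃ c : K, x - c • z ∈ H) (hp : IsPol f H pH) (hpp : pH ≤ pG) (hzp : z ∈ pG)
    (hl0 : l ≠ 0) (hl : IsEig f ρ pG l) (hH : IsGood f ρ H pH l) : IsGood f ρ G pG l := by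
  have hcyc := cyc_eq_of_stabilizer hρ hle hz.1 hG (hl z hzp)
  have hnorm : ∀ x ∈ G, ρ x l ∈ K ∙ l → x ∈ pG := by
    intro x hx hxl
    obtain ⟨c, hc⟩ := hG x hx
    have h1 : x - c • z ∈ pH := by
      refine hH.norm _ hc ?_
      rw [map_sub, map_smul, LinearMap.sub_apply, LinearMap.smul_apply, hl z hzp]
      exact sub_mem hxl (Submodule.smul_mem _ _ (Submodule.smul_mem _ _
        (Submodule.mem_span_singleton_self l)))
    have := add_mem (hpp h1) (pG.smul_mem c hzp)
    simpa using this
  refine ⟨fun W hW hWle h0 => hH.irr W (hW.mono hle) (hcyc ▸ hWle) h0, hnorm,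
    fun v hv hev => hH.eig v (hcyc ▸ hv) fun y hy => hev y (hpp hy), fun x T hT hTy => ?_⟩
  rw [hcyc] at hT hTy
  obtain ⟨x', hx', hxx⟩ := hH.ext x T hT fun y hy => hTy y (hle hy)
  have hTy' : ∀ y ∈ G, ∀ v ∈ cyc ρ H (K ∙ l),
      (T + ρ x') (ρ y v) - ρ y ((T + ρ x') v) = ρ ⁅x + x', y⁆ v := by
    intro y hy v hv
    have := hTy y hy v hv
    rw [add_lie, map_add, LinearMap.add_apply, LinearMap.add_apply, LinearMap.add_apply, ← this,
      hρ x' (hle hx') y hy, map_add]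
    abel
  have hll := mem_cyc_self (ρ := ρ) (G := H) l
  have hTl : (T + ρ x') l ∈ K ∙ l := by
    refine hH.eig _ (add_mem (hT l hll) (stable_cyc _ x' hx' l hll)) fun y hy => ?_
    have h1 := hTy' y (hle (hp.le y hy)) l hll
    obtain ⟨h2, h3⟩ := hp.lie _ hxx y hy
    rw [hl _ (hpp h2), h3, zero_smul, hl y (hpp hy), map_smul, sub_eq_zero] at h1
    exact h1.symm
  obtain ⟨c, hc⟩ := Submodule.mem_span_singleton.1 hTl
  -- Both `T + ρ x'` and `ρ z` act on `l` by scalars, so their commutator kills `l`. By `hnorm` the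
  -- bracket lies in `pG`, where the eigenvalue on `l` is `f`.
  have hzl : ρ ⁅x + x', z⁆ l = 0 := by
    rw [← hTy' z hz.1 l hll, hl z hzp, map_smul, ← hc, map_smul, hl z hzp, smul_comm, sub_self]
  have hmem : ⁅x + x', z⁆ ∈ pG := by
    refine hnorm _ (lie_mem_right K L G _ z hz.1) ?_
    rw [hzl]
    exact zero_mem _
  have hf : f ⁅x + x', z⁆ = 0 := by
    rw [hl _ hmem] at hzl
    exact (smul_eq_zero.1 hzl).resolve_right hl0
  refine ⟨x', hle hx', fun y hy => ?_⟩
  obtain ⟨c, hc⟩ := hG y hy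
  have := hxx _ hc
  rw [lie_sub, lie_smul, map_sub, map_smul, hf, smul_zero, sub_zero] at this
  exact this

theorem IsRepOn.isTower (hρ : IsRepOn ρ G) (hle : H ≤ G) (hz : z ∈ G) {V1 : Submodule K V}
    (h : Stable ρ H V1) : IsTower ρ H z V1 :=
  ⟨fun y hy v => by rw [hρ z hz y (hle hy)]; abel, h⟩

/-- An operator implementing `ad z` would provide `x' ∈ H` with `z + x'` stabilizing `f` on `H`.
Since `f([x', y]) = 0`, this would give `f([z, y]) = 0`. -/
theorem IsGood.noExt (hH : IsGood f ρ H pH l) {y : L} (hy : y ∈ stabilizer f H)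
    (hzy : f ⁅z, y⁆ ≠ 0) : NoExt ρ H z (cyc ρ H (K ∙ l)) := by
  intro T hT hTy
  obtain ⟨x', hx', h⟩ := hH.ext z T hT hTy
  have h1 := h y hy.1
  have h2 := hy.2 x' hx'
  rw [← lie_skew, map_neg, neg_eq_zero] at h2
  rw [add_lie, map_add, h2, add_zero] at h1
  exact hzy h1

theorem IsGood.cyc_le_of_stable (hH : IsGood f ρ H pH l) :
    ∀ W, Stable ρ H W → W ≤ cyc ρ H (K ∙ l) → W ≠ ⊥ → cyc ρ H (K ∙ l) ≤ W :=
  fun W hW hWle h0 => cyc_span_le (hH.irr W hW hWle h0) hW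

theorem cyc_le_iSup_tower (hρ : IsRepOn ρ G) (hle : H ≤ G) (hz : z ∈ G)
    (hG : ∀ x ∈ G, ∃ c : K, x - c • z ∈ H) :
    ∀ v ∈ cyc ρ G (K ∙ l), ∃ n, v ∈ tower (ρ z) (cyc ρ H (K ∙ l)) n := by
  have ht := hρ.isTower hle hz (stable_cyc (ρ := ρ) (G := H) (K ∙ l))
  have hmono := tower_mono (V1 := cyc ρ H (K ∙ l)) (ρ z)
  have hdir : Directed (· ≤ ·) (tower (ρ z) (cyc ρ H (K ∙ l))) := hmono.directed_le
  have : cyc ρ G (K ∙ l) ≤ ⨆ n, tower (ρ z) (cyc ρ H (K ∙ l)) n := by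
    refine cyc_span_le (Submodule.mem_iSup_of_mem 1 ?_) fun x hx v hv => ?_
    · rw [tower_one]
      exact mem_cyc_self l
    · obtain ⟨n, hn⟩ := (Submodule.mem_iSup_of_directed _ hdir).1 hv
      obtain ⟨c, hc⟩ := hG x hx
      have := add_mem (hmono (Nat.le_succ n) (ht.stable_tower n _ hc v hn))
        (Submodule.smul_mem _ c (apply_mem_tower (ρ z) hn))
      exact Submodule.mem_iSup_of_mem (n + 1) (by simpa using this)
  exact fun v hv => (Submodule.mem_iSup_of_directed _ hdir).1 (this hv)

/-- If `ad z` is not implemented on the `H`-module generated by `l`, every nonzero `H`-submodule of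
the `G`-module generated by `l` contains `l`. -/
theorem IsGood.mem_of_stable [CharZero K] (hρ : IsRepOn ρ G) (hle : H ≤ G) (hz : z ∈ G)
    (hG : ∀ x ∈ G, ∃ c : K, x - c • z ∈ H) (hH : IsGood f ρ H pH l)
    (hne : NoExt ρ H z (cyc ρ H (K ∙ l))) {W : Submodule K V} (hW : Stable ρ H W)
    (hWle : W ≤ cyc ρ G (K ∙ l)) (h0 : W ≠ ⊥) : l ∈ W := by
  have ht := hρ.isTower hle hz (stable_cyc (ρ := ρ) (G := H) (K ∙ l))
  obtain ⟨w, hw, hw0⟩ := Submodule.exists_mem_ne_zero_of_ne_bot h0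
  obtain ⟨n, hn⟩ := cyc_le_iSup_tower hρ hle hz hG w (hWle hw)
  have h1 : W ⊓ tower (ρ z) (cyc ρ H (K ∙ l)) n ≠ ⊥ :=
    fun hb => hw0 ((Submodule.mem_bot K).1 (hb ▸ ⟨hw, hn⟩))
  have h2 := ht.inf_ne_bot hne hH.cyc_le_of_stable n _ (hW.inf (ht.stable_tower n)) inf_le_right h1
  exact (hH.irr _ ((hW.inf (ht.stable_tower n)).inf (stable_cyc _)) inf_le_right h2).1.1

/-- Schur's lemma for the module generated by an eigenvector. -/
theorem IsGood.exists_eq_smul (hH : IsGood f ρ H pH l) (hp : IsPol f H pH) (hl : IsEig f ρ pH l)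
    (S : Module.End K V) (hS : ∀ v ∈ cyc ρ H (K ∙ l), S v ∈ cyc ρ H (K ∙ l))
    (hSy : ∀ y ∈ H, ∀ v ∈ cyc ρ H (K ∙ l), S (ρ y v) = ρ y (S v)) :
    ∃ c : K, ∀ v ∈ cyc ρ H (K ∙ l), S v = c • v := by
  have hll := mem_cyc_self (ρ := ρ) (G := H) l
  obtain ⟨c, hc⟩ := Submodule.mem_span_singleton.1 (hH.eig (S l) (hS l hll) fun y hy => by
    rw [← hSy y (hp.le y hy) l hll, hl y hy, map_smul])
  refine ⟨c, fun v hv => ?_⟩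
  have := map_cyc_le (ρ := ρ) (G := H) (S := K ∙ l) (W := ⊥) (T := S - c • 1) Stable.bot
    (fun v hv => by
      obtain ⟨a, rfl⟩ := Submodule.mem_span_singleton.1 hv
      simp [← hc]) (fun y hy v hv => by simp [hSy y hy v hv]) v hv
  simpa [sub_eq_zero] using this

/-- Essentiality of `U(H) l` gives irreducibility. An element outside `H` preserving `K l` would
make `z` preserve `U(H) l` and implement `ad z`. The hypothesis `hH` ranges over all eigenvectors
because the third property applies it to another eigenvector `v`. -/
theorem IsGood.of_stabilizer_le [CharZero K] (hρ : IsRepOn ρ G) (hle : H ≤ G) (hz : z ∈ G)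
    (hG : ∀ x ∈ G, ∃ c : K, x - c • z ∈ H) (hp : IsPol f H pH) {y : L} (hy : y ∈ stabilizer f H)
    (hzy : f ⁅z, y⁆ ≠ 0) (hl0 : l ≠ 0) (hl : IsEig f ρ pH l)
    (hH : ∀ l : V, l ≠ 0 → IsEig f ρ pH l → IsGood f ρ H pH l) : IsGood f ρ G pH l := by
  have hHl := hH l hl0 hl
  have hne := hHl.noExt hy hzy
  have ht := hρ.isTower hle hz (stable_cyc (ρ := ρ) (G := H) (K ∙ l))
  have hll := mem_cyc_self (ρ := ρ) (G := H) l
  have hmono := tower_mono (V1 := cyc ρ H (K ∙ l)) (ρ z)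
  refine ⟨fun W hW => hHl.mem_of_stable hρ hle hz hG hne (hW.mono hle), fun x hx hxl => ?_,
    fun v hv hev => ?_, fun x T hT hTy => ?_⟩
  · obtain ⟨c, hc⟩ := hG x hx
    by_cases hc0 : c = 0
    · rw [hc0, zero_smul, sub_zero] at hc
      exact hHl.norm x hc hxl
    · exfalso
      have hzl : ρ z l ∈ cyc ρ H (K ∙ l) := by
        have h1 := sub_mem (le_cyc (ρ := ρ) (G := H) _ hxl) (stable_cyc _ _ hc l hll)
        have h2 := Submodule.smul_mem _ c⁻¹ h1
        simpa [hc0] using h2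
      have hzc := map_cyc_le (ρ := ρ) (G := H) (S := K ∙ l) (T := ρ z) (stable_cyc _)
        (fun v hv => by
          obtain ⟨a, rfl⟩ := Submodule.mem_span_singleton.1 hv
          rw [map_smul]
          exact Submodule.smul_mem _ _ hzl)
        (fun y hy v hv => by
          rw [← hρ z hz y (hle hy)]
          exact stable_cyc _ _ (lie_mem_right K L H z y hy) v hv)
      exact hne (ρ z) hzc fun y hy v _ => (hρ z hz y (hle hy) v).symm
  · by_cases hv0 : v = 0
    · rw [hv0]
      exact zero_mem _
    -- By essentiality `U(H) v` contains `l`; goodness of `v`, not of `l`, then puts `l` in `K v`.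
    have hvle : cyc ρ H (K ∙ v) ≤ cyc ρ G (K ∙ l) := cyc_span_le hv ((stable_cyc _).mono hle)
    have hlv : l ∈ cyc ρ H (K ∙ v) := by
      refine hHl.mem_of_stable hρ hle hz hG hne (stable_cyc _) hvle fun h0 => hv0 ?_
      exact (Submodule.mem_bot K).1 (h0 ▸ mem_cyc_self v)
    have hvl := (hH v hv0 hev).eig l hlv hl
    obtain ⟨a, rfl⟩ := Submodule.mem_span_singleton.1 hvl
    have ha : a ≠ 0 := fun ha => hl0 (by rw [ha, zero_smul])
    exact Submodule.mem_span_singleton.2 ⟨a⁻¹, inv_smul_smul₀ ha v⟩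
  · have hcle := cyc_mono_ideal (ρ := ρ) hle (K ∙ l)
    obtain ⟨n, hn⟩ := cyc_le_iSup_tower hρ hle hz hG _ (hT l (hcle hll))
    have hTy1 : ∀ y ∈ H, ∀ v ∈ cyc ρ H (K ∙ l), T (ρ y v) - ρ y (T v) ∈ cyc ρ H (K ∙ l) := by
      intro y hy v hv
      rw [hTy y (hle hy) v (hcle hv)]
      exact stable_cyc _ _ (lie_mem_right K L H x y hy) v hv
    have hn2 : ∀ v ∈ cyc ρ H (K ∙ l), T v ∈ tower (ρ z) (cyc ρ H (K ∙ l)) (n + 2) := by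
      refine map_cyc_le (ht.stable_tower _) (fun v hv => ?_) fun y hy v hv => ?_
      · obtain ⟨a, rfl⟩ := Submodule.mem_span_singleton.1 hv
        rw [map_smul]
        exact Submodule.smul_mem _ _ (hmono (by omega) hn)
      · refine hmono (show 1 ≤ n + 2 by omega) ?_
        rw [tower_one]
        exact hTy1 y hy v hv
    obtain ⟨c, hc⟩ := ht.exists_sub_smul_mem hne hHl.cyc_le_of_stable
      (hHl.exists_eq_smul hp hl) hTy1 n hn2
    obtain ⟨x', hx', hxx⟩ := hHl.ext (x - c • z) (T - c • ρ z) hc fun y hy v hv => by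
      have h1 := hTy y (hle hy) v (hcle hv)
      have h2 := hρ z hz y (hle hy) v
      simp only [LinearMap.sub_apply, LinearMap.smul_apply, sub_lie, smul_lie, map_sub, map_smul,
        ← h1, h2, smul_sub]
      abel
    set a := x - c • z + x' with ha
    have hyz : f ⁅y, z⁆ ≠ 0 := by
      rwa [← lie_skew, map_neg, neg_ne_zero]
    -- Adding a multiple of `y` does not disturb vanishing on `H`; this multiple makes `f([a + t y,
    -- z])` vanish.
    let t : K := -(f ⁅a, z⁆) / f ⁅y, z⁆
    refine ⟨-(c • z) + x' + t • y, add_mem (add_mem (neg_mem (G.smul_mem c hz)) (hle hx'))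
      (G.smul_mem t (hle hy.1)), fun w hw => ?_⟩
    have e : x + (-(c • z) + x' + t • y) = a + t • y := by
      rw [ha]
      abel
    obtain ⟨d, hd⟩ := hG w hw
    have h1 : f ⁅a + t • y, w - d • z⁆ = 0 := by
      rw [add_lie, smul_lie, map_add, map_smul, hxx _ hd, hy.2 _ hd, smul_zero, add_zero]
    have h2 : f ⁅a + t • y, z⁆ = 0 := by
      rw [add_lie, smul_lie, map_add, map_smul, smul_eq_mul, div_mul_cancel₀ _ hyz, add_neg_cancel]
    rw [e]
    rw [lie_sub, lie_smul, map_sub, map_smul, h2, smul_zero, sub_zero] at h1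
    exact h1

end Model

/-! ### The induction along the filtration, and recovery of the polarization from the module -/

section Chain

variable {K : Type u} [Field K] {L : Type v} [LieRing L] [LieAlgebra K L] {k : ℕ}
  {V : Type w} [AddCommGroup V] [Module K V]

/-- The Vergne polarization `∑_{j ≥ i} 𝔤ⱼ^{fⱼ}` of the restriction of `f` to `𝔤ᵢ`. -/
def pvFrom (s : Filtration K L k) (f : Module.Dual K L) (i : Fin (k + 1)) : Submodule K L :=
  ⨆ j, ⨆ (_ : i ≤ j), stabilizer f (s.ideal j)

variable (s : Filtration K L k) (f : Module.Dual K L)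

theorem stabilizer_le_pvFrom {i j : Fin (k + 1)} (h : i ≤ j) :
    stabilizer f (s.ideal j) ≤ pvFrom s f i :=
  le_iSup₂_of_le (f := fun j (_ : i ≤ j) => stabilizer f (s.ideal j)) j h le_rfl

theorem pvFrom_antitone : Antitone (pvFrom s f) :=
  fun _ _ h => iSup₂_le fun _ hj => stabilizer_le_pvFrom s f (h.trans hj)

theorem pvFrom_zero : pvFrom s f 0 = (pv s f).toSubmodule := by
  simp [pvFrom, pv]

theorem pvFrom_castSucc (i : Fin k) :
    pvFrom s f i.castSucc = stabilizer f (s.ideal i.castSucc) ⊔ pvFrom s f i.succ := by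
  refine le_antisymm (iSup₂_le fun j hj => ?_) (sup_le (stabilizer_le_pvFrom s f le_rfl)
    (pvFrom_antitone s f i.castSucc_le_succ))
  rcases hj.eq_or_lt with rfl | hj
  · exact le_sup_left
  · exact le_sup_of_le_right (stabilizer_le_pvFrom s f (Fin.castSucc_lt_iff_succ_le.1 hj))

/-- By the Jacobi identity, an element stabilizing `f` on `𝔤ᵢ` normalizes each stabilizer `𝔤ⱼ^{fⱼ}`
with `j ≥ i`. -/
theorem isPol_pvFrom (i : Fin (k + 1)) : IsPol f (s.ideal i) (pvFrom s f i) := by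
  constructor
  · have : pvFrom s f i ≤ (s.ideal i).toSubmodule :=
      iSup₂_le fun j hj x hx => s.antitone hj hx.1
    exact fun y hy => this hy
  · intro a ha
    have : pvFrom s f i ≤ (pvFrom s f i).comap (LieAlgebra.ad K L a) ⊓
        LinearMap.ker (f ∘ₗ (LieAlgebra.ad K L a)) := by
      refine iSup₂_le fun j hj y hy => ⟨stabilizer_le_pvFrom s f hj ?_, ?_⟩
      · refine ⟨lie_mem_right K L _ a y hy.1, fun w hw => ?_⟩
        have hji := s.antitone hj
        rw [LieAlgebra.ad_apply]
        rw [lie_lie, map_sub, ha _ (hji (lie_mem_right K L _ y w hw)),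
          hy.2 _ (lie_mem_right K L _ a w hw), sub_zero]
      · exact ha y (s.antitone hj hy.1)
    exact fun y hy => this hy

variable {f} in
theorem pvFrom_congr {f' : Module.Dual K L} {i : Fin (k + 1)} (h : ∀ x ∈ s.ideal i, f x = f' x) :
    pvFrom s f i = pvFrom s f' i := by
  have : ∀ j, i ≤ j → stabilizer f (s.ideal j) = stabilizer f' (s.ideal j) := by
    intro j hj
    ext x
    refine and_congr_right fun _ => forall₂_congr fun y hy => ?_
    rw [h _ (s.antitone hj (lie_mem_right K L _ x y hy))]
  exact iSup_congr fun j => iSup_congr fun hj => this j hj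

theorem Filtration.exists_generator (i : Fin k) :
    ∃ z ∈ s.ideal i.castSucc, ∀ x ∈ s.ideal i.castSucc, ∃ c : K, x - c • z ∈ s.ideal i.succ := by
  obtain ⟨v, hv⟩ := rank_le_one_iff.1 (s.codim_le_one i)
  obtain ⟨z, rfl⟩ := Submodule.mkQ_surjective _ v
  refine ⟨z, z.2, fun x hx => ?_⟩
  obtain ⟨c, hc⟩ := hv (Submodule.mkQ _ ⟨x, hx⟩)
  refine ⟨c, ?_⟩
  rw [← map_smul] at hc
  have := (Submodule.Quotient.eq _).1 hc.symm
  exact this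

theorem Filtration.ideal_succ_le (i : Fin k) : s.ideal i.succ ≤ s.ideal i.castSucc :=
  s.antitone i.castSucc_le_succ

theorem Filtration.fg (i : Fin (k + 1)) : (s.ideal i).toSubmodule.FG := by
  induction i using Fin.reverseInduction with
  | last =>
    rw [s.ideal_last]
    exact Submodule.fg_bot
  | cast i ih =>
    obtain ⟨z, hz, hG⟩ := s.exists_generator i
    have : (s.ideal i.castSucc).toSubmodule = (K ∙ z) ⊔ (s.ideal i.succ).toSubmodule := by
      refine le_antisymm (fun x hx => ?_) (sup_le ?_ (s.ideal_succ_le i))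
      · obtain ⟨c, hc⟩ := hG x hx
        exact Submodule.mem_sup.2 ⟨c • z,
          Submodule.smul_mem _ _ (Submodule.mem_span_singleton_self z), x - c • z, hc, by abel⟩
      · exact (Submodule.span_singleton_le_iff_mem z _).2 hz
    rw [this]
    exact (Submodule.fg_span_singleton z).sup ih

variable {f} in
/-- A functional on `H` vanishing on the stabilizer of `f` lies in the coadjoint orbit
directions `f([·, H])`. -/
theorem exists_eq_lie {H : LieIdeal K L} (hH : H.toSubmodule.FG) {φ : Module.Dual K L}
    (hφ : ∀ y ∈ stabilizer f H, φ y = 0) : ∃ w ∈ H, ∀ y ∈ H, φ y = f ⁅y, w⁆ := by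
  have : Module.Finite K H.toSubmodule := Module.Finite.of_fg hH
  let B : H.toSubmodule →ₗ[K] Module.Dual K H.toSubmodule :=
    LinearMap.mk₂ K (fun u v => f ⁅(u : L), (v : L)⁆) (by simp) (by simp) (by simp) (by simp)
  -- The kernel of `B` is the stabilizer, and its annihilator is the range of the transpose of `B`.
  -- Reflexivity in finite dimension turns the preimage into a vector `w`.
  have hmem : φ.domRestrict H.toSubmodule ∈ LinearMap.range B.dualMap := by
    rw [LinearMap.range_dualMap_eq_dualAnnihilator_ker, Submodule.mem_dualAnnihilator]
    intro y hy
    exact hφ y ⟨y.2, fun v hv => DFunLike.congr_fun (LinearMap.mem_ker.1 hy) ⟨v, hv⟩⟩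
  obtain ⟨ψ, hψ⟩ := hmem
  obtain ⟨w, rfl⟩ := (Module.evalEquiv K H.toSubmodule).surjective ψ
  exact ⟨w, w.2, fun y hy => (DFunLike.congr_fun hψ ⟨y, hy⟩).symm⟩

/-- Either the stabilizer of `f` in `𝔤ᵢ` supplements `𝔤ᵢ₊₁`, or it is contained in it. -/
theorem stabilizer_dichotomy (i : Fin k) :
    (∃ z ∈ stabilizer f (s.ideal i.castSucc),
      ∀ x ∈ s.ideal i.castSucc, ∃ c : K, x - c • z ∈ s.ideal i.succ) ∨
    (pvFrom s f i.castSucc = pvFrom s f i.succ ∧ ∃ z ∈ s.ideal i.castSucc, z ∉ s.ideal i.succ ∧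
      (∀ x ∈ s.ideal i.castSucc, ∃ c : K, x - c • z ∈ s.ideal i.succ) ∧
      ∃ y ∈ stabilizer f (s.ideal i.succ), f ⁅z, y⁆ ≠ 0) := by
  obtain ⟨z, hz, hG⟩ := s.exists_generator i
  by_cases hzH : z ∈ s.ideal i.succ
  -- Here the two ideals coincide, and `0` serves as supplement.
  · refine Or.inl ⟨0, zero_mem _, fun x hx => ⟨0, ?_⟩⟩
    obtain ⟨c, hc⟩ := hG x hx
    have := add_mem hc ((s.ideal i.succ).smul_mem c hzH)
    simpa using this
  by_cases hst : ∃ a ∈ stabilizer f (s.ideal i.castSucc), a ∉ s.ideal i.succ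
  · obtain ⟨a, ha, haH⟩ := hst
    refine Or.inl ⟨a, ha, fun x hx => ?_⟩
    obtain ⟨c, hc⟩ := hG x hx
    obtain ⟨d, hd⟩ := hG a ha.1
    have hd0 : d ≠ 0 := by
      rintro rfl
      exact haH (by simpa using hd)
    refine ⟨c * d⁻¹, ?_⟩
    have := sub_mem hc ((s.ideal i.succ).smul_mem (c * d⁻¹) hd)
    rw [smul_sub, smul_smul, inv_mul_cancel_right₀ hd0] at this
    convert this using 1
    abel
  push Not at hst
  refine Or.inr ⟨?_, z, hz, hzH, hG, ?_⟩
  · rw [pvFrom_castSucc, sup_eq_right]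
    refine le_trans (b := stabilizer f (s.ideal i.succ))
      (fun x hx => ⟨hst x hx, fun y hy => hx.2 y (s.ideal_succ_le i hy)⟩)
      (stabilizer_le_pvFrom s f le_rfl)
  · by_contra! hcon
    -- If `f([z, ·])` vanished on the stabilizer in `𝔤ᵢ₊₁`, it would equal `f([·, w])` on `𝔤ᵢ₊₁`.
    -- Then `z + w` would stabilize `f` on all of `𝔤ᵢ` while lying outside `𝔤ᵢ₊₁`.
    obtain ⟨w, hw, hwy⟩ := exists_eq_lie (s.fg i.succ)
      (φ := f ∘ₗ (LieAlgebra.ad K L z)) (f := f) hcon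
    have hzw : ∀ y ∈ s.ideal i.succ, f ⁅z + w, y⁆ = 0 := by
      intro y hy
      have : f ⁅z, y⁆ = f ⁅y, w⁆ := hwy y hy
      rw [add_lie, map_add, this, ← map_add, ← lie_skew w y, add_neg_cancel, map_zero]
    have hzz : f ⁅z + w, z⁆ = 0 := by
      have := hzw w hw
      rw [add_lie, lie_self, add_zero] at this
      rw [add_lie, lie_self, zero_add, ← lie_skew, map_neg, this, neg_zero]
    refine hzH ?_
    have : z + w ∈ s.ideal i.succ := by
      refine hst _ ⟨add_mem hz (s.ideal_succ_le i hw), fun x hx => ?_⟩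
      obtain ⟨c, hc⟩ := hG x hx
      have := hzw _ hc
      rw [lie_sub, lie_smul, map_sub, map_smul, hzz, smul_zero, sub_zero] at this
      exact this
    simpa using sub_mem this hw

theorem cyc_bot_ideal (ρ : L →ₗ[K] Module.End K V) (S : Submodule K V) :
    cyc ρ (⊥ : LieIdeal K L) S = S := by
  refine le_antisymm (cyc_le le_rfl fun x hx w _ => ?_) (le_cyc S)
  rw [LieSubmodule.mem_bot] at hx
  simp [hx]

variable {ρ : L →ₗ[K] Module.End K V}

/-- The module need not be induced: any nonzero eigenvector of the polarization suffices. This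
allows use in quotients, twisted doubles and unknown irreducible modules. -/
theorem isGood_pvFrom [CharZero K] (i : Fin (k + 1)) (hρ : IsRepOn ρ (s.ideal i)) {l : V}
    (hl0 : l ≠ 0) (hl : IsEig f ρ (pvFrom s f i) l) :
    IsGood f ρ (s.ideal i) (pvFrom s f i) l := by
  induction i using Fin.reverseInduction generalizing l with
  | last =>
    rw [s.ideal_last]
    refine ⟨fun W _ hW h0 => ?_, fun x hx _ => ?_, fun v hv _ => ?_, fun x _ _ _ => ⟨0, ?_⟩⟩
    · rw [cyc_bot_ideal] at hW
      obtain ⟨w, hw, hw0⟩ := Submodule.exists_mem_ne_zero_of_ne_bot h0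
      obtain ⟨a, rfl⟩ := Submodule.mem_span_singleton.1 (hW hw)
      have ha : a ≠ 0 := fun ha => hw0 (by rw [ha, zero_smul])
      have := W.smul_mem a⁻¹ hw
      rwa [inv_smul_smul₀ ha] at this
    · rw [LieSubmodule.mem_bot] at hx
      rw [hx]
      exact zero_mem _
    · rwa [cyc_bot_ideal] at hv
    · refine ⟨zero_mem _, fun y hy => ?_⟩
      rw [LieSubmodule.mem_bot] at hy
      simp [hy]
  | cast i ih =>
    have hle := s.ideal_succ_le i
    have ih' := fun l => ih (l := l) (hρ.mono hle)
    rcases stabilizer_dichotomy s f i with ⟨z, hz, hG⟩ | ⟨hpv, z, hz, -, hG, y, hy, hzy⟩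
    · have hpp := pvFrom_antitone s f i.castSucc_le_succ
      exact IsGood.of_stabilizer hρ hle hz hG (isPol_pvFrom s f _) hpp
        (stabilizer_le_pvFrom s f le_rfl hz) hl0 hl (ih' l hl0 fun y hy => hl y (hpp hy))
    · rw [hpv] at hl ⊢
      exact IsGood.of_stabilizer_le hρ hle hz hG (isPol_pvFrom s f _) hy hzy hl0 hl ih'

/-- Every nonzero `𝔤ᵢ₊₁`-submodule of `U(𝔤ᵢ) l` contains `l`. -/
theorem mem_of_stable_succ [CharZero K] (i : Fin k) (hρ : IsRepOn ρ (s.ideal i.castSucc)) {l : V}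
    (hl0 : l ≠ 0) (hl : IsEig f ρ (pvFrom s f i.castSucc) l) {W : Submodule K V}
    (hW : Stable ρ (s.ideal i.succ) W) (hWle : W ≤ cyc ρ (s.ideal i.castSucc) (K ∙ l))
    (h0 : W ≠ ⊥) : l ∈ W := by
  have hle := s.ideal_succ_le i
  have hgood := isGood_pvFrom s f i.succ (hρ.mono hle) hl0
    fun y hy => hl y (pvFrom_antitone s f i.castSucc_le_succ hy)
  rcases stabilizer_dichotomy s f i with ⟨z, hz, hG⟩ | ⟨hpv, z, hz, -, hG, y, hy, hzy⟩
  · rw [cyc_eq_of_stabilizer hρ hle hz.1 hG (hl z (stabilizer_le_pvFrom s f le_rfl hz))] at hWle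
    exact hgood.irr W hW hWle h0
  · exact hgood.mem_of_stable hρ hle hz hG (hgood.noExt hy hzy) hW hWle h0

/-- The chain `U(𝔤ᵢ) l`, and hence the line `K l`, are determined by the module. -/
theorem span_eq_span [CharZero K] {f' f'' : Module.Dual K L} (hρ : IsRepOn ρ (s.ideal 0))
    {l' l'' : V} (hl' : l' ≠ 0) (hl'' : l'' ≠ 0) (he' : IsEig f' ρ (pvFrom s f' 0) l')
    (he'' : IsEig f'' ρ (pvFrom s f'' 0) l'')
    (h : cyc ρ (s.ideal 0) (K ∙ l') = cyc ρ (s.ideal 0) (K ∙ l'')) : (K ∙ l') = (K ∙ l'') := by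
  -- Equality at level `i` makes `U(𝔤ᵢ₊₁) l''` a nonzero submodule of `U(𝔤ᵢ) l'`, so it contains
  -- `l'`; the argument is symmetric. At level `k` the modules are the lines.
  have key : ∀ i, cyc ρ (s.ideal i) (K ∙ l') = cyc ρ (s.ideal i) (K ∙ l'') := by
    intro i
    induction i using Fin.induction with
    | zero => exact h
    | succ i ih =>
      have hρi := hρ.mono (s.antitone (Fin.zero_le i.castSucc))
      have hle := s.ideal_succ_le i
      have hne : ∀ l : V, l ≠ 0 → cyc ρ (s.ideal i.succ) (K ∙ l) ≠ ⊥ := fun l hl h0 =>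
        hl ((Submodule.mem_bot K).1 (h0 ▸ mem_cyc_self l))
      refine le_antisymm (cyc_span_le ?_ (stable_cyc _)) (cyc_span_le ?_ (stable_cyc _))
      · refine mem_of_stable_succ s f' i hρi hl'
          (fun y hy => he' y (pvFrom_antitone s f' (Fin.zero_le _) hy)) (stable_cyc _) ?_
          (hne _ hl'')
        rw [ih]
        exact cyc_mono_ideal hle _
      · refine mem_of_stable_succ s f'' i hρi hl''
          (fun y hy => he'' y (pvFrom_antitone s f'' (Fin.zero_le _) hy)) (stable_cyc _) ?_
          (hne _ hl')
        rw [← ih]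
        exact cyc_mono_ideal hle _
  have := key (Fin.last k)
  rwa [s.ideal_last, cyc_bot_ideal, cyc_bot_ideal] at this

/-- The polarization is the set of elements preserving the line, and `f` on it is the eigenvalue. -/
theorem pvFrom_le_of_span_eq [CharZero K] {f' f'' : Module.Dual K L} (hρ : IsRepOn ρ (s.ideal 0))
    {l' l'' : V} (hl'' : l'' ≠ 0) (he' : IsEig f' ρ (pvFrom s f' 0) l')
    (he'' : IsEig f'' ρ (pvFrom s f'' 0) l'') (h : (K ∙ l') = (K ∙ l'')) :
    ∀ x ∈ pvFrom s f' 0, x ∈ pvFrom s f'' 0 ∧ f' x = f'' x := by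
  intro x hx
  have hmem : l'' ∈ K ∙ l' := h ▸ Submodule.mem_span_singleton_self l''
  obtain ⟨c, rfl⟩ := Submodule.mem_span_singleton.1 hmem
  have hx'' : ρ x (c • l') = f' x • c • l' := by rw [map_smul, he' x hx, smul_comm]
  have hxp : x ∈ pvFrom s f'' 0 := by
    refine (isGood_pvFrom s f'' 0 hρ hl'' he'').norm x ?_ ?_
    · rw [s.ideal_zero]
      exact LieSubmodule.mem_top x
    · rw [hx'']
      exact Submodule.smul_mem _ _ (Submodule.mem_span_singleton_self _)
  refine ⟨hxp, ?_⟩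
  rw [he'' x hxp] at hx''
  exact (smul_left_injective K hl'' hx'').symm

end Chain

/-! ### Extending a representation from `H` to `K z + H` -/

section Extension

variable {K : Type u} [Field K] {L : Type v} [LieRing L] [LieAlgebra K L]
  {V : Type w} [AddCommGroup V] [Module K V]
  {ρ : L →ₗ[K] Module.End K V} {G H : LieIdeal K L} {z : L}

theorem cyc_congr {ρ' : L →ₗ[K] Module.End K V} (h : ∀ y ∈ H, ρ y = ρ' y) (S : Submodule K V) :
    cyc ρ H S = cyc ρ' H S :=
  le_antisymm (cyc_le (le_cyc S) fun y hy w hw => h y hy ▸ stable_cyc S y hy w hw)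
    (cyc_le (le_cyc S) fun y hy w hw => h y hy ▸ stable_cyc S y hy w hw)

/-- A functional that vanishes on `H` and takes a prescribed value at `z ∉ H`. -/
theorem exists_dual_eq_one (hzH : z ∉ H) :
    ∃ θ : Module.Dual K L, θ z = 1 ∧ ∀ y ∈ H, θ y = 0 := by
  obtain ⟨θ, h1, h2⟩ := Submodule.exists_le_ker_of_notMem (p := H.toSubmodule) hzH
  refine ⟨(θ z)⁻¹ • θ, by simp [h1], fun y hy => ?_⟩
  simp [LinearMap.mem_ker.1 (h2 hy)]

/-- A representation of `H` and an operator implementing `ad z` define a representation of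
`K z + H`. -/
theorem exists_extension (hρ : IsRepOn ρ H) (hzH : z ∉ H)
    (hG : ∀ x ∈ G, ∃ c : K, x - c • z ∈ H) {Z : Module.End K V}
    (hZ : ∀ y ∈ H, ∀ v, Z (ρ y v) - ρ y (Z v) = ρ ⁅z, y⁆ v) :
    ∃ ρ' : L →ₗ[K] Module.End K V, IsRepOn ρ' G ∧ (∀ y ∈ H, ρ' y = ρ y) ∧ ρ' z = Z := by
  obtain ⟨θ, hθz, hθ⟩ := exists_dual_eq_one hzH
  let ρ' : L →ₗ[K] Module.End K V := ρ + θ.smulRight (Z - ρ z)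
  have h1 : ∀ y ∈ H, ρ' y = ρ y := fun y hy => by simp [ρ', hθ y hy]
  have h2 : ρ' z = Z := by simp [ρ', hθz]
  refine ⟨ρ', fun x hx y hy v => ?_, h1, h2⟩
  obtain ⟨c, hc⟩ := hG x hx
  obtain ⟨d, hd⟩ := hG y hy
  obtain ⟨a, rfl⟩ : ∃ a, x = c • z + a := ⟨x - c • z, by abel⟩
  obtain ⟨b, rfl⟩ : ∃ b, y = d • z + b := ⟨y - d • z, by abel⟩
  rw [add_sub_cancel_left] at hc hd
  have e : ⁅c • z + a, d • z + b⁆ = c • ⁅z, b⁆ - d • ⁅z, a⁆ + ⁅a, b⁆ := by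
    simp only [lie_add, add_lie, lie_smul, smul_lie, lie_self, smul_zero, ← lie_skew a z]
    module
  have hzb := lie_mem_right K L H z b hd
  have hza := lie_mem_right K L H z a hc
  rw [e]
  simp only [map_add, map_sub, map_smul, h1 _ hc, h1 _ hd, h1 _ hzb, h1 _ hza, h2,
    h1 _ (lie_mem_right K L H a b hd), LinearMap.add_apply, LinearMap.sub_apply,
    LinearMap.smul_apply, hρ a hc b hd, ← hZ b hd, ← hZ a hc, smul_add, smul_sub, smul_comm d c]
  abel

/-- The extension of `V` by itself defined by the derivation `ad z`. -/
def twistedDouble (ρ : L →ₗ[K] Module.End K V) (z : L) : L →ₗ[K] Module.End K (V × V) where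
  toFun y := (ρ y ∘ₗ LinearMap.fst K V V + ρ ⁅z, y⁆ ∘ₗ LinearMap.snd K V V).prod
    (ρ y ∘ₗ LinearMap.snd K V V)
  map_add' x y := by
    ext <;> simp
  map_smul' c y := by
    ext <;> simp

theorem twistedDouble_apply (y : L) (a b : V) :
    twistedDouble ρ z y (a, b) = (ρ y a + ρ ⁅z, y⁆ b, ρ y b) := rfl

/-- The off-diagonal entry satisfies the cocycle condition because `ad z` is a derivation. -/
theorem isRepOn_twistedDouble (hρ : IsRepOn ρ H) : IsRepOn (twistedDouble ρ z) H := by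
  rintro x hx y hy ⟨a, b⟩
  have hzy := lie_mem_right K L H z y hy
  have hzx := lie_mem_right K L H z x hx
  simp only [twistedDouble_apply, leibniz_lie z x y, map_add, LinearMap.add_apply, hρ x hx y hy,
    hρ _ hzx y hy, hρ x hx _ hzy, Prod.mk_sub_mk, Prod.mk.injEq, and_true]
  abel

/-- If the twisted double has an `H`-submodule that projects isomorphically onto the second factor,
`ad z` is implemented by an operator. -/
theorem exists_operator {W : Submodule K (V × V)} (hW : Stable (twistedDouble ρ z) H W)
    (hinj : ∀ a, (a, (0 : V)) ∈ W → a = 0) (hsurj : ∀ b, ∃ a, (a, b) ∈ W) :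
    ∃ T : Module.End K V, (∀ y ∈ H, ∀ v, T (ρ y v) - ρ y (T v) = ρ ⁅z, y⁆ v) ∧
      ∀ a b, (a, b) ∈ W → T b = a := by
  -- `W` is the graph of the desired `T`; its invariance is the commutation relation.
  let e : W →ₗ[K] V := LinearMap.snd K V V ∘ₗ W.subtype
  have he : Function.Bijective e := by
    constructor
    · rw [← LinearMap.ker_eq_bot, LinearMap.ker_eq_bot']
      rintro ⟨⟨a, b⟩, hab⟩ h
      obtain rfl : b = 0 := h
      exact Subtype.ext (Prod.ext (hinj a hab) rfl)
    · intro b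
      obtain ⟨a, ha⟩ := hsurj b
      exact ⟨⟨(a, b), ha⟩, rfl⟩
  let E := LinearEquiv.ofBijective e he
  let T : Module.End K V := LinearMap.fst K V V ∘ₗ W.subtype ∘ₗ E.symm.toLinearMap
  have hT : ∀ a b, (a, b) ∈ W → T b = a := by
    intro a b hab
    have : E.symm b = ⟨(a, b), hab⟩ := by
      rw [LinearEquiv.symm_apply_eq]
      rfl
    simp [T, this]
  refine ⟨T, fun y hy v => ?_, hT⟩
  obtain ⟨a, ha⟩ := hsurj v
  rw [hT _ _ ha, hT (ρ y a + ρ ⁅z, y⁆ v) (ρ y v) (hW y hy _ ha)]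
  abel

/-- The shift operator on `V[X]`. -/
def shift : Module.End K (ℕ →₀ V) := Finsupp.lmapDomain V K Nat.succ

theorem shift_single (n : ℕ) (v : V) :
    shift (K := K) (Finsupp.single n v) = Finsupp.single (n + 1) v := by
  simp [shift, Finsupp.mapDomain_single]

/-- The action of `y` on the monomials `Xⁿ v`, determined by `y X = X y - [z, y]`. -/
def monomialAction (ρ : L →ₗ[K] Module.End K V) (z : L) : ℕ → L →ₗ[K] V →ₗ[K] (ℕ →₀ V)
  | 0 => LinearMap.llcomp K V V (ℕ →₀ V) (Finsupp.lsingle 0) ∘ₗ ρ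
  | n + 1 => LinearMap.llcomp K V (ℕ →₀ V) (ℕ →₀ V) shift ∘ₗ monomialAction ρ z n -
      monomialAction ρ z n ∘ₗ LieAlgebra.ad K L z

/-- The action of `H` on `V[X]`, the module induced from `H` to `K z + H`. -/
def inducedAction (ρ : L →ₗ[K] Module.End K V) (z : L) : L →ₗ[K] Module.End K (ℕ →₀ V) where
  toFun y := Finsupp.lsum K fun n => monomialAction ρ z n y
  map_add' x y := by
    ext
    simp
  map_smul' c y := by
    ext
    simp

theorem inducedAction_single (y : L) (n : ℕ) (v : V) :
    inducedAction ρ z y (Finsupp.single n v) = monomialAction ρ z n y v := by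
  simp [inducedAction]

theorem inducedAction_single_zero (y : L) (v : V) :
    inducedAction ρ z y (Finsupp.single 0 v) = Finsupp.single 0 (ρ y v) := by
  simp [inducedAction_single, monomialAction]

theorem inducedAction_shift (y : L) (p : ℕ →₀ V) :
    inducedAction ρ z y (shift (K := K) p) =
      shift (K := K) (inducedAction ρ z y p) - inducedAction ρ z ⁅z, y⁆ p := by
  induction p using Finsupp.induction_linear with
  | zero => simp
  | add p q hp hq =>
    simp only [map_add, hp, hq]
    abel
  | single n v => simp [shift_single, inducedAction_single, monomialAction]

theorem isRepOn_inducedAction (hρ : IsRepOn ρ H) : IsRepOn (inducedAction ρ z) H := by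
  intro x hx y hy p
  induction p using Finsupp.induction_linear with
  | zero => simp
  | add p q hp hq =>
    simp only [map_add, hp, hq]
    abel
  | single n v =>
    induction n generalizing x y with
    | zero => simp only [inducedAction_single_zero, hρ x hx y hy, Finsupp.single_sub]
    | succ n ih =>
      have hzy := lie_mem_right K L H z y hy
      have hzx := lie_mem_right K L H z x hx
      rw [← shift_single (K := K)]
      simp only [inducedAction_shift, map_sub, leibniz_lie z x y, map_add, LinearMap.add_apply,
        ih _ hzx y hy, ih x hx _ hzy, ih x hx y hy]
      abel

end Extension

/-! ### Nonzero modules with an eigenvector of the polarization -/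

section Existence

variable {K : Type u} [Field K] {L : Type v} [LieRing L] [LieAlgebra K L] {k : ℕ}
  (s : Filtration K L k) (f : Module.Dual K L)

/-- When `z` stabilizes `f`, the polarization of `fᵢ` grows at most by `z`: a stabilizing element
minus its multiple of `z` still stabilizes `f`, now inside `𝔤ᵢ₊₁`. -/
theorem exists_sub_smul_mem_pvFrom {i : Fin k} {z : L}
    (hz : z ∈ stabilizer f (s.ideal i.castSucc))
    (hG : ∀ x ∈ s.ideal i.castSucc, ∃ c : K, x - c • z ∈ s.ideal i.succ) :
    ∀ x ∈ pvFrom s f i.castSucc, ∃ c : K, x - c • z ∈ pvFrom s f i.succ := by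
  intro x hx
  rw [pvFrom_castSucc] at hx
  obtain ⟨a, ha, b, hb, rfl⟩ := Submodule.mem_sup.1 hx
  obtain ⟨c, hc⟩ := hG a ha.1
  refine ⟨c, ?_⟩
  have h1 : a - c • z ∈ stabilizer f (s.ideal i.succ) :=
    ⟨hc, fun y hy => (sub_mem ha (Submodule.smul_mem _ c hz)).2 y (s.ideal_succ_le i hy)⟩
  have := add_mem (stabilizer_le_pvFrom s f le_rfl h1) hb
  convert this using 1
  abel

/-- There is a cyclic `𝔤ᵢ`-module generated by a nonzero eigenvector of `𝔭𝔳(fᵢ)`. -/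
theorem exists_model [CharZero K] (i : Fin (k + 1)) :
    ∃ (V : Type u) (_ : AddCommGroup V) (_ : Module K V) (ρ : L →ₗ[K] Module.End K V) (l : V),
      IsRepOn ρ (s.ideal i) ∧ l ≠ 0 ∧ IsEig f ρ (pvFrom s f i) l ∧
        cyc ρ (s.ideal i) (K ∙ l) = ⊤ := by
  induction i using Fin.reverseInduction with
  | last =>
    refine ⟨K, inferInstance, inferInstance, 0, 1, fun x _ y _ v => by simp, one_ne_zero,
      fun y hy => ?_, ?_⟩
    · have := (isPol_pvFrom s f (Fin.last k)).le y hy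
      rw [s.ideal_last, LieSubmodule.mem_bot] at this
      simp [this]
    · rw [s.ideal_last, cyc_bot_ideal]
      exact Ideal.span_singleton_one
  | cast i ih =>
    obtain ⟨V, _, _, ρ, l, hρ, hl0, hl, hcyc⟩ := ih
    have hle := s.ideal_succ_le i
    rcases stabilizer_dichotomy s f i with ⟨z, hz, hG⟩ | ⟨hpv, z, hz, hzH, hG, -⟩
    · have hpv := exists_sub_smul_mem_pvFrom s f hz hG
      by_cases hzH : z ∈ s.ideal i.succ
      · have hle' : s.ideal i.castSucc ≤ s.ideal i.succ := by
          intro x hx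
          obtain ⟨c, hc⟩ := hG x hx
          simpa using add_mem hc ((s.ideal i.succ).smul_mem c hzH)
        refine ⟨V, _, _, ρ, l, hρ.mono hle', hl0, fun x hx => hl x ?_, ?_⟩
        · obtain ⟨c, hc⟩ := hpv x hx
          have hz' : z ∈ stabilizer f (s.ideal i.succ) := ⟨hzH, fun y hy => hz.2 y (hle hy)⟩
          simpa using add_mem hc (Submodule.smul_mem _ c (stabilizer_le_pvFrom s f le_rfl hz'))
        · exact top_le_iff.1 (hcyc ▸ cyc_mono_ideal hle _)
      -- The operator `T` implementing `ad z` has as its graph the submodule generated by `(0, l)`.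
      -- This vector is an eigenvector because `[z, y]` stays in the polarization with `f([z, y]) =
      -- 0`. By irreducibility the submodule meets the first factor trivially.
      · have hgood := isGood_pvFrom s f i.succ (ρ := twistedDouble ρ z) (l := ((0 : V), l))
          (isRepOn_twistedDouble hρ) (fun h => hl0 (Prod.ext_iff.1 h).2) (fun y hy => by
            obtain ⟨h1, h2⟩ := (isPol_pvFrom s f i.succ).lie z (fun y hy => hz.2 y (hle hy)) y hy
            rw [twistedDouble_apply, hl y hy, hl _ h1, h2]
            simp)
        set W := cyc (twistedDouble ρ z) (s.ideal i.succ) (K ∙ ((0 : V), l)) with hW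
        obtain ⟨T, hT, hTW⟩ := exists_operator (ρ := ρ) (z := z) (W := W)
          (H := s.ideal i.succ) (stable_cyc _) (fun a ha => by
            by_contra ha0
            have := hgood.irr (W ⊓ LinearMap.ker (LinearMap.snd K V V))
              ((stable_cyc _).inf fun y hy w hw => by
                rw [LinearMap.mem_ker, LinearMap.snd_apply] at hw ⊢
                change ρ y w.2 = 0
                rw [hw, map_zero]) inf_le_left
              (fun h0 => ha0 (Prod.ext_iff.1 ((Submodule.mem_bot K).1
                (h0 ▸ ⟨ha, rfl⟩ : (a, (0 : V)) ∈ (⊥ : Submodule K (V × V))))).1)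
            exact hl0 this.2) (fun b => by
            have : (⊤ : Submodule K V) ≤ W.map (LinearMap.snd K V V) := by
              rw [← hcyc]
              refine cyc_span_le ⟨_, mem_cyc_self _, rfl⟩ ?_
              rintro y hy _ ⟨w, hw, rfl⟩
              exact ⟨_, stable_cyc _ y hy w hw, rfl⟩
            obtain ⟨⟨a, b⟩, hab, rfl⟩ := this (Submodule.mem_top (x := b))
            exact ⟨a, hab⟩)
        have hTl : T l = 0 := hTW 0 l (mem_cyc_self _)
        -- Since `T l = 0`, adding the scalar `f z` gives `z` the right eigenvalue without changing
        -- commutators.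
        obtain ⟨ρ', hρ', h1, h2⟩ := exists_extension hρ hzH hG (Z := T + f z • 1) (fun y hy v => by
          rw [← hT y hy v]
          simp)
        refine ⟨V, _, _, ρ', l, hρ', hl0, fun x hx => ?_, ?_⟩
        · obtain ⟨c, hc⟩ := hpv x hx
          have e1 := hl _ hc
          rw [← h1 _ ((isPol_pvFrom s f i.succ).le _ hc), map_sub, map_smul, h2] at e1
          simp only [LinearMap.sub_apply, LinearMap.smul_apply, LinearMap.add_apply, hTl,
            Module.End.one_apply, zero_add, map_sub, map_smul, sub_smul, smul_eq_mul,
            mul_smul] at e1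
          exact sub_left_injective e1
        · exact top_le_iff.1 (hcyc ▸ cyc_congr (fun y hy => (h1 y hy).symm) (K ∙ l) ▸
            cyc_mono_ideal hle _)
    -- The polarization is unchanged, so the induced module `V[X]`, with `z` acting as
    -- multiplication by `X`, keeps the eigenvector `l`.
    · obtain ⟨ρ', hρ', h1, h2⟩ := exists_extension (isRepOn_inducedAction (z := z) hρ) hzH hG
        (Z := shift) (fun y hy v => by rw [inducedAction_shift]; abel)
      have h0 : ∀ y ∈ s.ideal i.succ, ∀ v, ρ' y (Finsupp.single 0 v) = Finsupp.single 0 (ρ y v) :=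
        fun y hy v => by rw [h1 y hy, inducedAction_single_zero]
      refine ⟨ℕ →₀ V, _, _, ρ', Finsupp.single 0 l, hρ', by simpa using hl0, fun y hy => ?_, ?_⟩
      · rw [hpv] at hy
        rw [h0 y ((isPol_pvFrom s f i.succ).le _ hy), hl y hy, Finsupp.smul_single]
      · rw [eq_top_iff]
        intro p _
        have hsing : ∀ n v, Finsupp.single n v ∈
            cyc ρ' (s.ideal i.castSucc) (K ∙ Finsupp.single 0 l) := by
          intro n
          induction n with
          | zero =>
            intro v
            have : (⊤ : Submodule K V) ≤ (cyc ρ' (s.ideal i.castSucc)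
                (K ∙ Finsupp.single 0 l)).comap (Finsupp.lsingle 0) := by
              rw [← hcyc]
              refine cyc_span_le (mem_cyc_self _) fun y hy w hw => ?_
              have := stable_cyc _ y (hle hy) _ hw
              rw [Finsupp.lsingle_apply, h0 y hy] at this
              exact this
            exact this (Submodule.mem_top (x := v))
          | succ n ih =>
            intro v
            rw [← shift_single (K := K), ← h2]
            exact stable_cyc _ z hz _ (ih v)
        induction p using Finsupp.induction_linear with
        | zero => exact zero_mem _
        | add p q hp hq => exact add_mem (hp trivial) (hq trivial)
        | single n v => exact hsing n v

end Existence

/-! ### Eigenvectors in modules generated by several eigenvectors -/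

section Isotypic

variable {K : Type u} [Field K] {L : Type v} [LieRing L] [LieAlgebra K L] {k : ℕ}
  {V : Type w} [AddCommGroup V] [Module K V] {ρ : L →ₗ[K] Module.End K V}

/-- The common eigenvectors of `ρ(p)` with eigenvalue `f`. -/
def eigSpace (f : Module.Dual K L) (ρ : L →ₗ[K] Module.End K V) (p : Submodule K L) :
    Submodule K V where
  carrier := {v | IsEig f ρ p v}
  zero_mem' := fun y _ => by simp
  add_mem' := fun ha hb y hy => by rw [map_add, ha y hy, hb y hy, smul_add]
  smul_mem' := fun c v hv y hy => by rw [map_smul, hv y hy, smul_comm]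

/-- The representation of `H` on the quotient by an invariant subspace. -/
theorem exists_quotient_rep {H : LieIdeal K L} {N : Submodule K V} (hN : Stable ρ H N) :
    ∃ ρ' : L →ₗ[K] Module.End K (V ⧸ N), ∀ y ∈ H, ∀ v, ρ' y (N.mkQ v) = N.mkQ (ρ y v) := by
  let r : H.toSubmodule →ₗ[K] Module.End K (V ⧸ N) :=
    { toFun := fun y => N.mapQ N (ρ y) (hN y y.2)
      map_add' := fun x y => by
        ext
        simp
      map_smul' := fun c y => by
        ext
        simp }
  obtain ⟨ρ', hρ'⟩ := r.exists_extend
  refine ⟨ρ', fun y hy v => ?_⟩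
  have : ρ' y = r ⟨y, hy⟩ := DFunLike.congr_fun hρ' ⟨y, hy⟩
  rw [this]
  rfl

variable (s : Filtration K L k) (f : Module.Dual K L)

/-- Modulo the submodule `N` generated by the other eigenvectors, `e` either vanishes or generates a
good module. In the latter case the image of `v` is a multiple `c` of that of `e`, and induction
applies to `v - c e`. -/
theorem mem_span_of_mem_cyc [CharZero K] {i : Fin (k + 1)} (hρ : IsRepOn ρ (s.ideal i))
    (S : Finset V) (hS : ∀ e ∈ S, IsEig f ρ (pvFrom s f i) e) :
    ∀ v ∈ eigSpace f ρ (pvFrom s f i), v ∈ cyc ρ (s.ideal i) (Submodule.span K (S : Set V)) →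
      v ∈ Submodule.span K (S : Set V) := by
  classical
  induction S using Finset.induction_on with
  | empty =>
    intro v _ hv
    rw [Finset.coe_empty, Submodule.span_empty] at hv ⊢
    exact cyc_le le_rfl Stable.bot hv
  | insert e S _ ih =>
    intro v hv hvc
    have ih' := ih fun e he => hS e (Finset.mem_insert_of_mem he)
    have heig : e ∈ eigSpace f ρ (pvFrom s f i) := hS e (Finset.mem_insert_self e S)
    have hspan : Submodule.span K ((insert e S : Finset V) : Set V) =
        (K ∙ e) ⊔ Submodule.span K (S : Set V) := by
      rw [Finset.coe_insert, Submodule.span_insert]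
    rw [hspan] at hvc ⊢
    set N := cyc ρ (s.ideal i) (Submodule.span K (S : Set V)) with hNdef
    have hN : Stable ρ (s.ideal i) N := stable_cyc _
    by_cases heN : e ∈ N
    · have := ih' e heig heN
      rw [sup_eq_right.2 ((Submodule.span_singleton_le_iff_mem _ _).2 this)] at hvc ⊢
      exact ih' v hv hvc
    · obtain ⟨ρ', hρ'⟩ := exists_quotient_rep hN
      have hpv := (isPol_pvFrom s f i).le
      have hrep : IsRepOn ρ' (s.ideal i) := by
        intro x hx y hy w
        obtain ⟨w, rfl⟩ := N.mkQ_surjective w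
        rw [hρ' _ (lie_mem_right K L _ x y hy), hρ x hx y hy, hρ' y hy, hρ' x hx, hρ' x hx,
          hρ' y hy, map_sub]
      have hq : ∀ v, IsEig f ρ (pvFrom s f i) v → IsEig f ρ' (pvFrom s f i) (N.mkQ v) :=
        fun v hv y hy => by rw [hρ' y (hpv y hy), hv y hy, map_smul]
      have hgood := isGood_pvFrom s f i hrep (l := N.mkQ e)
        (fun h => heN ((Submodule.Quotient.mk_eq_zero N).1 h)) (hq e heig)
      have hle : cyc ρ (s.ideal i) ((K ∙ e) ⊔ Submodule.span K (S : Set V)) ≤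
          (cyc ρ' (s.ideal i) (K ∙ N.mkQ e)).comap N.mkQ := by
        refine cyc_le (sup_le ?_ ?_) fun y hy w hw => ?_
        · rw [Submodule.span_singleton_le_iff_mem]
          exact mem_cyc_self _
        · intro w hw
          have : N.mkQ w = 0 := (Submodule.Quotient.mk_eq_zero N).2 (le_cyc _ hw)
          rw [Submodule.mem_comap, this]
          exact zero_mem _
        · rw [Submodule.mem_comap, ← hρ' y hy]
          exact stable_cyc _ y hy _ hw
      obtain ⟨c, hc⟩ := Submodule.mem_span_singleton.1 (hgood.eig _ (hle hvc) (hq v hv))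
      have hmem : v - c • e ∈ N := by
        rw [← map_smul] at hc
        exact (Submodule.Quotient.eq N).1 hc.symm
      have := ih' _ (sub_mem hv (Submodule.smul_mem _ c heig)) hmem
      exact Submodule.mem_sup.2 ⟨c • e,
        Submodule.smul_mem _ _ (Submodule.mem_span_singleton_self e), _, this, by abel⟩

theorem exists_finset_mem_cyc {H : LieIdeal K L} {E : Submodule K V} {v : V}
    (hv : v ∈ cyc ρ H E) :
    ∃ S : Finset V, (S : Set V) ⊆ E ∧ v ∈ cyc ρ H (Submodule.span K (S : Set V)) := by
  classical
  let W : Submodule K V :=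
    { carrier := {v | ∃ S : Finset V, (S : Set V) ⊆ E ∧ v ∈ cyc ρ H (Submodule.span K (S : Set V))}
      zero_mem' := ⟨∅, by simp, zero_mem _⟩
      add_mem' := by
        rintro a b ⟨S, hS, ha⟩ ⟨T, hT, hb⟩
        refine ⟨S ∪ T, by simp [hS, hT], add_mem (cyc_mono (Submodule.span_mono ?_) ha)
          (cyc_mono (Submodule.span_mono ?_) hb)⟩ <;> simp
      smul_mem' := by
        rintro c a ⟨S, hS, ha⟩
        exact ⟨S, hS, Submodule.smul_mem _ c ha⟩ }
  have : cyc ρ H E ≤ W := by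
    refine cyc_le (fun e he => ⟨{e}, by simpa using he, ?_⟩) ?_
    · rw [Finset.coe_singleton]
      exact mem_cyc_self e
    · rintro y hy w ⟨S, hS, hw⟩
      exact ⟨S, hS, stable_cyc _ y hy w hw⟩
  exact this hv

/-- An eigenvector in the module generated by a space of eigenvectors belongs to that space. -/
theorem mem_of_mem_cyc [CharZero K] {i : Fin (k + 1)} (hρ : IsRepOn ρ (s.ideal i))
    {E : Submodule K V} (hE : E ≤ eigSpace f ρ (pvFrom s f i)) {v : V}
    (hv : v ∈ eigSpace f ρ (pvFrom s f i)) (hvc : v ∈ cyc ρ (s.ideal i) E) : v ∈ E := by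
  obtain ⟨S, hS, hvS⟩ := exists_finset_mem_cyc hvc
  exact Submodule.span_le.2 hS
    (mem_span_of_mem_cyc s f hρ S (fun e he => hE (hS he)) v hv hvS)

end Isotypic

/-! ### Finding `f` in an irreducible module over an algebraically closed field -/

section AlgClosed

open Polynomial

variable {K : Type u} [Field K] {L : Type v} [LieRing L] [LieAlgebra K L] {k : ℕ}
  {V : Type w} [AddCommGroup V] [Module K V] {ρ : L →ₗ[K] Module.End K V}

theorem aeval_apply_mem {Z : Module.End K V} {W : Submodule K V} (hZ : ∀ v ∈ W, Z v ∈ W) {v : V}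
    (hv : v ∈ W) (p : K[X]) : aeval Z p v ∈ W := by
  induction p using Polynomial.induction_on' with
  | add p q hp hq =>
    rw [map_add]
    exact add_mem hp hq
  | monomial n a =>
    rw [aeval_monomial, Module.End.mul_apply, Module.algebraMap_end_apply]
    refine W.smul_mem a ?_
    induction n with
    | zero => simpa using hv
    | succ n ih =>
      rw [pow_succ', Module.End.mul_apply]
      exact hZ _ ih

/-- A vector annihilated by a nonzero polynomial in `Z` yields an eigenvector. -/
theorem exists_eigenvector [IsAlgClosed K] {Z : Module.End K V} {l : V} (hl : l ≠ 0) {q : K[X]}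
    (hq : q ≠ 0) (hql : aeval Z q l = 0) :
    ∃ (r : K[X]) (c : K), aeval Z r l ≠ 0 ∧ Z (aeval Z r l) = c • aeval Z r l := by
  induction hn : q.natDegree using Nat.strong_induction_on generalizing q with
  | _ n ih =>
    have hdeg : q.degree ≠ 0 := by
      intro h0
      rw [eq_C_of_degree_eq_zero h0, aeval_C, Module.algebraMap_end_apply] at hql
      have hc := (smul_eq_zero.1 hql).resolve_right hl
      rw [eq_C_of_degree_eq_zero h0, hc, map_zero] at hq
      exact hq rfl
    obtain ⟨c, hc⟩ := IsAlgClosed.exists_root q hdeg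
    obtain ⟨r, rfl⟩ := dvd_iff_isRoot.2 hc
    have hr : r ≠ 0 := right_ne_zero_of_mul hq
    rw [map_mul, Module.End.mul_apply] at hql
    by_cases he : aeval Z r l = 0
    · refine ih _ ?_ hr he rfl
      rw [← hn, natDegree_mul (X_sub_C_ne_zero c) hr, natDegree_X_sub_C]
      omega
    · refine ⟨r, c, he, ?_⟩
      simpa [sub_eq_zero] using hql

variable (s : Filtration K L k) (f : Module.Dual K L)

/-- In an irreducible `𝔤ᵢ`-module, an eigenvector of `𝔭𝔳(fᵢ₊₁)` is an eigenvector of the elements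
stabilizing `f`. -/
theorem exists_eq_smul_of_stabilizer [CharZero K] [IsAlgClosed K] {i : Fin k}
    (hρ : IsRepOn ρ (s.ideal i.castSucc)) {z : L} (hz : z ∈ stabilizer f (s.ideal i.castSucc))
    (hG : ∀ x ∈ s.ideal i.castSucc, ∃ c : K, x - c • z ∈ s.ideal i.succ) {l : V} (hl0 : l ≠ 0)
    (hl : l ∈ eigSpace f ρ (pvFrom s f i.succ)) {U : Submodule K V}
    (hU : Stable ρ (s.ideal i.castSucc) U) (hlU : l ∈ U)
    (hirr : ∀ W, Stable ρ (s.ideal i.castSucc) W → W ≤ U → W ≠ ⊥ → W = U) :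
    ∃ c : K, ρ z l = c • l := by
  have hle := s.ideal_succ_le i
  have hpol := isPol_pvFrom s f i.succ
  have hZ : ∀ v ∈ eigSpace f ρ (pvFrom s f i.succ) ⊓ U,
      ρ z v ∈ eigSpace f ρ (pvFrom s f i.succ) ⊓ U := by
    refine fun v hv => ⟨fun y hy => ?_, hU z hz.1 v hv.2⟩
    obtain ⟨h1, h2⟩ := hpol.lie z (fun y hy => hz.2 y (hle hy)) y hy
    have h3 := hρ z hz.1 y (hle (hpol.le y hy)) v
    rw [hv.1 _ h1, h2, zero_smul, hv.1 y hy, map_smul] at h3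
    exact (sub_eq_zero.1 h3.symm).symm
  obtain ⟨q, hq, hql⟩ : ∃ q : K[X], q ≠ 0 ∧ aeval (ρ z) q l = 0 := by
    by_cases hzl : ρ z l = 0
    · exact ⟨X, X_ne_zero, by simpa using hzl⟩
    -- `E = K[z] z l` is `z`-invariant and consists of eigenvectors, so it generates the same module
    -- over both ideals: all of `U`. Thus `l` lies in `E`, that is, `l = p(z) z l`.
    let E : Submodule K V :=
      LinearMap.range (LinearMap.applyₗ (ρ z l) ∘ₗ (aeval (ρ z)).toLinearMap)
    have hE : E ≤ eigSpace f ρ (pvFrom s f i.succ) ⊓ U := by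
      rintro _ ⟨p, rfl⟩
      exact aeval_apply_mem hZ (hZ l ⟨hl, hlU⟩) p
    have hzE : ρ z l ∈ E := ⟨1, by simp⟩
    have hcyc : cyc ρ (s.ideal i.castSucc) E = cyc ρ (s.ideal i.succ) E := by
      refine cyc_eq_of_codim hρ hle hz.1 hG ?_
      rintro _ ⟨p, rfl⟩
      exact le_cyc _ ⟨X * p, by simp⟩
    have hEU : cyc ρ (s.ideal i.castSucc) E = U :=
      hirr _ (stable_cyc _) (cyc_le (hE.trans inf_le_right) hU) fun h0 =>
        hzl ((Submodule.mem_bot K).1 (h0 ▸ le_cyc _ hzE))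
    have hlE : l ∈ E := by
      refine mem_of_mem_cyc s f (hρ.mono hle) (hE.trans inf_le_left) hl ?_
      rw [← hcyc, hEU]
      exact hlU
    obtain ⟨p, hp⟩ := hlE
    -- This polynomial is nonzero because its value at `0` is `1`.
    refine ⟨1 - p * X, fun h => ?_, ?_⟩
    · have := congrArg (eval 0) h
      simp at this
    · rw [map_sub, map_mul, map_one, aeval_X, LinearMap.sub_apply, Module.End.mul_apply,
        Module.End.one_apply, sub_eq_zero]
      exact hp.symm
  obtain ⟨r, c, he0, hec⟩ := exists_eigenvector hl0 hq hql
  set e := aeval (ρ z) r l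
  have he : e ∈ eigSpace f ρ (pvFrom s f i.succ) ⊓ U := aeval_apply_mem hZ ⟨hl, hlU⟩ r
  have hcyc := cyc_eq_of_stabilizer hρ hle hz.1 hG hec
  have heU : cyc ρ (s.ideal i.castSucc) (K ∙ e) = U :=
    hirr _ (stable_cyc _) (cyc_span_le he.2 hU) fun h0 =>
      he0 ((Submodule.mem_bot K).1 (h0 ▸ mem_cyc_self e))
  -- The `z`-eigenvector `e` generates `U` already over `𝔤ᵢ₊₁`, so the eigenvector `l` is a multiple
  -- of `e`.
  have hel := (isGood_pvFrom s f i.succ (hρ.mono hle) he0 he.1).eig l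
    (by rw [← hcyc, heU]; exact hlU) hl
  obtain ⟨a, ha⟩ := Submodule.mem_span_singleton.1 hel
  exact ⟨c, by rw [← ha, map_smul, hec, smul_comm]⟩

/-- Going up from `𝔤ₖ = 0`, the functional is altered only outside `𝔤ᵢ₊₁`, to give `z` the
eigenvalue found on `l`. This preserves `𝔭𝔳(fᵢ₊₁)`, and `z` remains a stabilizer because in that
case `[𝔤ᵢ, 𝔤ᵢ] ⊆ 𝔤ᵢ₊₁`. -/
theorem exists_dual_isEig [CharZero K] [IsAlgClosed K] (hρ : IsRepOn ρ (s.ideal 0))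
    (U : Fin (k + 1) → Submodule K V) (hU : ∀ i, Stable ρ (s.ideal i) (U i)) {l : V} (hl0 : l ≠ 0)
    (hlU : ∀ i, l ∈ U i)
    (hirr : ∀ i W, Stable ρ (s.ideal i) W → W ≤ U i → W ≠ ⊥ → W = U i) (i : Fin (k + 1)) :
    ∃ f : Module.Dual K L, IsEig f ρ (pvFrom s f i) l := by
  induction i using Fin.reverseInduction with
  | last =>
    refine ⟨0, fun y hy => ?_⟩
    have := (isPol_pvFrom s 0 (Fin.last k)).le y hy
    rw [s.ideal_last, LieSubmodule.mem_bot] at this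
    simp [this]
  | cast i ih =>
    obtain ⟨f, hf⟩ := ih
    have hle := s.ideal_succ_le i
    have hρi := hρ.mono (s.antitone (Fin.zero_le i.castSucc))
    rcases stabilizer_dichotomy s f i with ⟨z, hz, hG⟩ | ⟨hpv, -⟩
    · obtain ⟨c, hc⟩ := exists_eq_smul_of_stabilizer s f hρi hz hG hl0 hf (hU _) (hlU _) (hirr _)
      obtain ⟨f', hf'z, hf'⟩ : ∃ f' : Module.Dual K L, f' z = c ∧
          ∀ y ∈ s.ideal i.succ, f y = f' y := by
        by_cases hzH : z ∈ s.ideal i.succ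
        · refine ⟨f, ?_, fun _ _ => rfl⟩
          have hz' : z ∈ stabilizer f (s.ideal i.succ) := ⟨hzH, fun y hy => hz.2 y (hle hy)⟩
          rw [hf z (stabilizer_le_pvFrom s f le_rfl hz')] at hc
          exact smul_left_injective K hl0 hc
        · obtain ⟨θ, h1, h2⟩ := exists_dual_eq_one hzH
          exact ⟨f + (c - f z) • θ, by simp [h1], fun y hy => by simp [h2 y hy]⟩
      refine ⟨f', fun x hx => ?_⟩
      have hlie : ∀ x ∈ s.ideal i.castSucc, ∀ y ∈ s.ideal i.castSucc, ⁅x, y⁆ ∈ s.ideal i.succ := by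
        intro x hx y hy
        obtain ⟨a, ha⟩ := hG x hx
        obtain ⟨b, hb⟩ := hG y hy
        have := add_mem (lie_mem_left K L _ _ y ha)
          ((s.ideal i.succ).smul_mem a (lie_mem_right K L _ z _ hb))
        simpa using this
      have hz' : z ∈ stabilizer f' (s.ideal i.castSucc) :=
        ⟨hz.1, fun y hy => by rw [← hf' _ (hlie z hz.1 y hy), hz.2 y hy]⟩
      obtain ⟨a, ha⟩ := exists_sub_smul_mem_pvFrom s f' hz' hG x hx
      rw [← pvFrom_congr s hf'] at ha
      have h1 := hf _ ha
      rw [hf' _ ((isPol_pvFrom s f _).le _ ha), map_sub, map_smul, map_sub, map_smul,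
        LinearMap.sub_apply, LinearMap.smul_apply, hc, hf'z, sub_smul, smul_eq_mul,
        mul_smul] at h1
      exact sub_left_injective h1
    · exact ⟨f, hpv ▸ hf⟩

end AlgClosed

attribute [local instance 100] LieRing.ofAssociativeRing

/-! ### The enveloping algebra and the universal property of induced modules -/

section Enveloping

variable {K : Type u} [Field K] {L : Type v} [LieRing L] [LieAlgebra K L]

/-- The elements satisfying `P` form a subalgebra containing `𝔤`, and the universal property gives a
section of its inclusion. -/
theorem env_induction {P : UniversalEnvelopingAlgebra K L → Prop}
    (algebraMap : ∀ c : K, P (algebraMap K _ c)) (ι : ∀ x, P (UniversalEnvelopingAlgebra.ι K x))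
    (mul : ∀ a b, P a → P b → P (a * b)) (sum : ∀ a b, P a → P b → P (a + b))
    (u : UniversalEnvelopingAlgebra K L) : P u := by
  let S : Subalgebra K (UniversalEnvelopingAlgebra K L) :=
    { carrier := {u | P u}
      mul_mem' := fun ha hb => mul _ _ ha hb
      add_mem' := fun ha hb => sum _ _ ha hb
      algebraMap_mem' := algebraMap }
  let j : L →ₗ⁅K⁆ S :=
    { toLinearMap := (UniversalEnvelopingAlgebra.ι K : L →ₗ⁅K⁆ _).toLinearMap.codRestrict
        (Subalgebra.toSubmodule S) ι
      map_lie' := fun {x y} => Subtype.ext ((UniversalEnvelopingAlgebra.ι K).map_lie x y) }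
  have : S.val.comp (UniversalEnvelopingAlgebra.lift K j) = AlgHom.id K _ := by
    apply UniversalEnvelopingAlgebra.hom_ext
    ext x
    simp only [LieHom.comp_apply, AlgHom.coe_toLieHom, AlgHom.comp_apply,
      UniversalEnvelopingAlgebra.lift_ι_apply]
    rfl
  have hu := DFunLike.congr_fun this u
  rw [AlgHom.comp_apply, AlgHom.id_apply] at hu
  rw [← hu]
  exact (UniversalEnvelopingAlgebra.lift K j u).2

/-- An eigenvector of the subalgebra `𝔥` is an eigenvector of `U(𝔥)`. -/
theorem lift_envIncl_apply {V : Type*} [AddCommGroup V] [Module K V] {ρ : L →ₗ⁅K⁆ Module.End K V}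
    {𝔥 : LieSubalgebra K L} {χ : LieAlgebra.LieCharacter K 𝔥} {l : V}
    (hl : ∀ x : 𝔥, ρ x l = χ x • l) (a : UniversalEnvelopingAlgebra K 𝔥) :
    UniversalEnvelopingAlgebra.lift K ρ (envIncl 𝔥 a) l =
      UniversalEnvelopingAlgebra.lift K (charRep χ) a (1 : K) • l := by
  induction a using env_induction with
  | algebraMap c => simp [Module.algebraMap_end_apply]
  | ι x =>
    simp only [envIncl, UniversalEnvelopingAlgebra.lift_ι_apply, LieHom.comp_apply]
    rw [LieSubalgebra.coe_incl, hl x]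
    simp [charRep]
  | mul a b ha hb =>
    have e : ∀ w : K, UniversalEnvelopingAlgebra.lift K (charRep χ) a w =
        w * UniversalEnvelopingAlgebra.lift K (charRep χ) a 1 := fun w => by
      conv_lhs => rw [← mul_one w, ← smul_eq_mul, map_smul, smul_eq_mul]
    rw [map_mul, map_mul, Module.End.mul_apply, hb, map_smul, ha, map_mul, Module.End.mul_apply,
      e (UniversalEnvelopingAlgebra.lift K (charRep χ) b 1), mul_smul]
  | sum a b ha hb => simp only [map_add, LinearMap.add_apply, ha, hb, add_smul]

/-- The universal property of the module induced from a character. -/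
theorem exists_hom_ind {V : Type*} [AddCommGroup V] [Module K V] {ρ : L →ₗ⁅K⁆ Module.End K V}
    {𝔥 : LieSubalgebra K L} {χ : LieAlgebra.LieCharacter K 𝔥} {l : V}
    (hl : ∀ x : 𝔥, ρ x l = χ x • l) :
    ∃ φ : Ind 𝔥 (charRep χ) →ₗ[K] V, φ ((indRel 𝔥 (charRep χ)).mkQ (1 ⊗ₜ[K] (1 : K))) = l ∧
      ∀ x m, φ (UniversalEnvelopingAlgebra.ι K x • m) = ρ x (φ m) := by
  let Φ := UniversalEnvelopingAlgebra.lift K ρ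
  let _ : Module (UniversalEnvelopingAlgebra K L) V := Module.compHom V Φ.toRingHom
  have hsmul : ∀ (u : UniversalEnvelopingAlgebra K L) (v : V), u • v = Φ u v := fun _ _ => rfl
  have : IsScalarTower K (UniversalEnvelopingAlgebra K L) V :=
    ⟨fun c u v => by rw [hsmul, hsmul, map_smul, LinearMap.smul_apply]⟩
  let F : UniversalEnvelopingAlgebra K L ⊗[K] K →ₗ[UniversalEnvelopingAlgebra K L] V :=
    (LinearMap.toSpanSingleton _ V l) ∘ₗ
      (TensorProduct.AlgebraTensorModule.rid K (UniversalEnvelopingAlgebra K L)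
        (UniversalEnvelopingAlgebra K L)).toLinearMap
  have hF : ∀ u c, F (u ⊗ₜ[K] c) = c • Φ u l := by
    intro u c
    simp [F, hsmul]
  have hker : indRel 𝔥 (charRep χ) ≤ LinearMap.ker F := by
    refine Submodule.span_le.2 ?_
    rintro _ ⟨u, a, w, rfl⟩
    have e : UniversalEnvelopingAlgebra.lift K (charRep χ) a w =
        w * UniversalEnvelopingAlgebra.lift K (charRep χ) a 1 := by
      conv_lhs => rw [← mul_one w, ← smul_eq_mul, map_smul, smul_eq_mul]
    rw [SetLike.mem_coe, LinearMap.mem_ker, map_sub, hF, hF, map_mul, Module.End.mul_apply,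
      lift_envIncl_apply hl, e, map_smul, mul_smul, sub_self]
  refine ⟨((indRel 𝔥 (charRep χ)).liftQ F hker).restrictScalars K, ?_, fun x m => ?_⟩
  · simp [hF]
  · rw [LinearMap.restrictScalars_apply, LinearMap.restrictScalars_apply, map_smul, hsmul]
    simp [Φ]

theorem envIncl_smul_mem {P : Type*} [AddCommGroup P] [Module K P]
    [Module (UniversalEnvelopingAlgebra K L) P] [IsScalarTower K (UniversalEnvelopingAlgebra K L) P]
    {𝔥 : LieSubalgebra K L} {W : Submodule K P}
    (hW : ∀ x ∈ 𝔥, ∀ m ∈ W, UniversalEnvelopingAlgebra.ι K x • m ∈ W)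
    (a : UniversalEnvelopingAlgebra K 𝔥) : ∀ m ∈ W, envIncl 𝔥 a • m ∈ W := by
  induction a using env_induction with
  | algebraMap c =>
    intro m hm
    rw [AlgHom.commutes, algebraMap_smul]
    exact W.smul_mem c hm
  | ι x =>
    intro m hm
    have : envIncl 𝔥 (UniversalEnvelopingAlgebra.ι K x) =
        UniversalEnvelopingAlgebra.ι K (x : L) := by
      simp only [envIncl, UniversalEnvelopingAlgebra.lift_ι_apply]
      rfl
    rw [this]
    exact hW x x.2 m hm
  | mul a b ha hb =>
    intro m hm
    rw [map_mul, mul_smul]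
    exact ha _ (hb m hm)
  | sum a b ha hb =>
    intro m hm
    rw [map_add, add_smul]
    exact add_mem (ha m hm) (hb m hm)

theorem indRel_congr {𝔥 𝔥' : LieSubalgebra K L} {χ : LieAlgebra.LieCharacter K 𝔥}
    {χ' : LieAlgebra.LieCharacter K 𝔥'} (h : 𝔥 = 𝔥')
    (hχ : ∀ (x : L) (hx : x ∈ 𝔥) (hx' : x ∈ 𝔥'), χ ⟨x, hx⟩ = χ' ⟨x, hx'⟩) :
    indRel 𝔥 (charRep χ) = indRel 𝔥' (charRep χ') := by
  subst h
  obtain rfl : χ = χ' := by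
    ext x
    exact hχ x x.2 x.2
  rfl

end Enveloping

/-! ### Transfer to `M(f)` and to `U(𝔤, s)`-modules -/

section FiltRep

variable {K : Type u} [Field K] {L : Type v} [LieRing L] [LieAlgebra K L] {k : ℕ}
  {s : Filtration K L k}

theorem FiltRep.isRepOn (A : FiltRep s) (I : LieIdeal K L) : IsRepOn A.ρ.toLinearMap I := by
  intro x _ y _ v
  change A.ρ ⁅x, y⁆ v = A.ρ x (A.ρ y v) - A.ρ y (A.ρ x v)
  rw [LieHom.map_lie, LieRing.of_associative_ring_bracket]
  rfl

variable (s) (f : Module.Dual K L)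

theorem ι_smul_gen {x : L} (hx : x ∈ pv s f) :
    UniversalEnvelopingAlgebra.ι K x • gen s f = f x • gen s f := by
  have h : (1 * envIncl (pv s f) (UniversalEnvelopingAlgebra.ι K ⟨x, hx⟩)) ⊗ₜ[K] (1 : K) -
      1 ⊗ₜ[K] (UniversalEnvelopingAlgebra.lift K (charRep (pvChar s f))
        (UniversalEnvelopingAlgebra.ι K ⟨x, hx⟩) (1 : K)) ∈
      indRel (pv s f) (charRep (pvChar s f)) :=
    Submodule.subset_span ⟨1, _, 1, rfl⟩
  have e1 : envIncl (pv s f) (UniversalEnvelopingAlgebra.ι K ⟨x, hx⟩) =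
      UniversalEnvelopingAlgebra.ι K x := by
    simp only [envIncl, UniversalEnvelopingAlgebra.lift_ι_apply]
    rfl
  have e2 : UniversalEnvelopingAlgebra.lift K (charRep (pvChar s f))
      (UniversalEnvelopingAlgebra.ι K ⟨x, hx⟩) (1 : K) = f x • (1 : K) := by
    simp only [UniversalEnvelopingAlgebra.lift_ι_apply]
    rfl
  rw [e1, e2, one_mul, TensorProduct.tmul_smul] at h
  have h2 := (Submodule.Quotient.eq _).2 h
  have h3 : UniversalEnvelopingAlgebra.ι K x • gen s f =
      (indRel (pv s f) (charRep (pvChar s f))).mkQ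
        (UniversalEnvelopingAlgebra.ι K x ⊗ₜ[K] (1 : K)) := by
    rw [gen, ← map_smul, TensorProduct.smul_tmul', smul_eq_mul, mul_one]
  rw [h3]
  exact h2

/-- The action of `𝔤` on `M(f)`. -/
def actM : L →ₗ[K] Module.End K (M s f) :=
  (Algebra.lsmul K K (M s f) :
    UniversalEnvelopingAlgebra K L →ₐ[K] Module.End K (M s f)).toLinearMap ∘ₗ
      (UniversalEnvelopingAlgebra.ι K : L →ₗ⁅K⁆ UniversalEnvelopingAlgebra K L).toLinearMap

theorem actM_apply (x : L) (m : M s f) :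
    actM s f x m = UniversalEnvelopingAlgebra.ι K x • m := rfl

theorem isRepOn_actM (I : LieIdeal K L) : IsRepOn (actM s f) I := by
  intro x _ y _ m
  rw [actM_apply, LieHom.map_lie, LieRing.of_associative_ring_bracket, sub_smul, mul_smul, mul_smul]
  rfl

theorem isEig_gen (i : Fin (k + 1)) : IsEig f (actM s f) (pvFrom s f i) (gen s f) := by
  intro x hx
  have := pvFrom_antitone s f (Fin.zero_le i) hx
  rw [pvFrom_zero] at this
  exact ι_smul_gen s f this

/-- The universal property maps `M(f)` to the explicit module and `gen` to its nonzero eigenvector,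
so no Poincaré–Birkhoff–Witt basis is needed. -/
theorem gen_ne_zero [CharZero K] : gen s f ≠ 0 := by
  obtain ⟨V, _, _, ρ, l, hρ, hl0, hl, -⟩ := exists_model s f 0
  rw [s.ideal_zero] at hρ
  rw [pvFrom_zero] at hl
  let ρ' : L →ₗ⁅K⁆ Module.End K V :=
    { ρ with
      map_lie' := fun {x y} => LinearMap.ext fun v =>
        hρ x (LieSubmodule.mem_top x) y (LieSubmodule.mem_top y) v }
  obtain ⟨φ, hφ, -⟩ := exists_hom_ind (ρ := ρ') (χ := pvChar s f) (l := l) fun x => hl x x.2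
  intro h
  exact hl0 (by rw [← hφ, ← gen, h, map_zero])

theorem Mfil_eq_cyc (i : Fin (k + 1)) :
    Mfil s f i = cyc (actM s f) (s.ideal i) (K ∙ gen s f) := by
  refine le_antisymm ?_ (cyc_span_le ?_ ((Ms s f).invariant i))
  · rintro _ ⟨_, ⟨a, rfl⟩, rfl⟩
    exact envIncl_smul_mem (W := cyc (actM s f) (s.ideal i) (K ∙ gen s f))
      (fun x hx m hm => stable_cyc (ρ := actM s f) _ x hx m hm) a _ (mem_cyc_self _)
  · exact ⟨1, (envSub _).one_mem, one_smul (UniversalEnvelopingAlgebra K L) (gen s f)⟩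

theorem Mfil_zero : Mfil s f 0 = ⊤ := (Ms s f).fil_zero

theorem Mfil_irreducible [CharZero K] (i : Fin (k + 1)) :
    Mfil s f i ≠ ⊥ ∧ ∀ W : Submodule K (M s f), W ≤ Mfil s f i →
      Stable (actM s f) (s.ideal i) W → W = ⊥ ∨ W = Mfil s f i := by
  have hgood := isGood_pvFrom s f i (isRepOn_actM s f _) (gen_ne_zero s f) (isEig_gen s f i)
  rw [Mfil_eq_cyc]
  refine ⟨fun h0 => gen_ne_zero s f ((Submodule.mem_bot K).1 (h0 ▸ mem_cyc_self _)),
    fun W hWle hW => or_iff_not_imp_left.2 fun h0 => le_antisymm hWle ?_⟩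
  exact hgood.cyc_le_of_stable W hW hWle h0

theorem Ms_isIrreducible [CharZero K] (f : Module.Dual K L) : (Ms s f).IsIrreducible :=
  Mfil_irreducible s f

theorem smul_equiv {f' f'' : Module.Dual K L} (C : M s f' ≃ₗ[K] M s f'')
    (hC : ∀ (x : L) m, C (UniversalEnvelopingAlgebra.ι K x • m) =
      UniversalEnvelopingAlgebra.ι K x • C m) (u : UniversalEnvelopingAlgebra K L) (m : M s f') :
    C (u • m) = u • C m := by
  induction u using env_induction generalizing m with
  | algebraMap c => rw [algebraMap_smul, algebraMap_smul, map_smul]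
  | ι x => exact hC x m
  | mul a b ha hb => rw [mul_smul, mul_smul, ha, hb]
  | sum a b ha hb => rw [add_smul, add_smul, map_add, ha, hb]

theorem exists_equiv_of_relR {f' f'' : Module.Dual K L}
    (h : pv s f' = pv s f'' ∧ ∀ x ∈ pv s f', f' x = f'' x) :
    ∃ C : M s f' ≃ₗ[UniversalEnvelopingAlgebra K L] M s f'', C (gen s f') = gen s f'' := by
  have heq : indRel (pv s f') (charRep (pvChar s f')) =
      indRel (pv s f'') (charRep (pvChar s f'')) :=
    indRel_congr h.1 fun x hx _ => h.2 x hx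
  exact ⟨Submodule.quotEquivOfEq _ _ heq, Submodule.quotEquivOfEq_mk _ _ heq _⟩

theorem map_Mfil {f' f'' : Module.Dual K L}
    (C : M s f' ≃ₗ[UniversalEnvelopingAlgebra K L] M s f'') (hC : C (gen s f') = gen s f'')
    (i : Fin (k + 1)) :
    (Mfil s f' i).map (C.restrictScalars K : M s f' →ₗ[K] M s f'') = Mfil s f'' i := by
  rw [Mfil, Mfil, ← Submodule.map_comp]
  congr 1
  refine LinearMap.ext fun u => ?_
  change C (u • gen s f') = u • gen s f''
  rw [map_smul, hC]

theorem equivalent_of_relR {f' f'' : Module.Dual K L}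
    (h : pv s f' = pv s f'' ∧ ∀ x ∈ pv s f', f' x = f'' x) :
    (Ms s f').Equivalent (Ms s f'') := by
  obtain ⟨C, hC⟩ := exists_equiv_of_relR s h
  exact ⟨C.restrictScalars K, map_Mfil s C hC, fun x (w : M s f') =>
    map_smul C (UniversalEnvelopingAlgebra.ι K x) w⟩

/-- The image of the generator of `M(f')` and the generator of `M(f'')` both generate `M(f'')` and
are eigenvectors of the respective polarizations, so they span the same line. -/
theorem relR_of_linearEquiv [CharZero K] {f' f'' : Module.Dual K L}
    (C : M s f' ≃ₗ[UniversalEnvelopingAlgebra K L] M s f'') :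
    pv s f' = pv s f'' ∧ ∀ x ∈ pv s f', f' x = f'' x := by
  have hρ := isRepOn_actM s f'' (s.ideal 0)
  have hl'0 : C (gen s f') ≠ 0 := by
    rw [Ne, LinearEquiv.map_eq_zero_iff]
    exact gen_ne_zero s f'
  have he' : IsEig f' (actM s f'') (pvFrom s f' 0) (C (gen s f')) := by
    intro x hx
    rw [pvFrom_zero] at hx
    rw [actM_apply, ← map_smul, ι_smul_gen s f' hx]
    exact (C.restrictScalars K).map_smul _ _
  have he'' := isEig_gen s f'' 0
  have htop : cyc (actM s f'') (s.ideal 0) (K ∙ C (gen s f')) = ⊤ := by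
    rw [eq_top_iff]
    intro m _
    obtain ⟨u, hu⟩ := gen_generates s f' (C.symm m)
    have hu' : u ∈ envSub (⊤ : LieSubalgebra K L) := by
      rw [envSub_top]
      trivial
    obtain ⟨a, ha⟩ := hu'
    have hm : m = envIncl ⊤ a • C (gen s f') := by
      rw [← map_smul, show envIncl ⊤ a = u from ha, hu, LinearEquiv.apply_symm_apply]
    rw [hm]
    refine envIncl_smul_mem (fun x _ w hw => ?_) a _ (mem_cyc_self _)
    refine stable_cyc (ρ := actM s f'') _ x ?_ w hw
    rw [s.ideal_zero]
    exact LieSubmodule.mem_top x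
  have hspan := span_eq_span s hρ hl'0 (gen_ne_zero s f'') he' he''
    (by rw [htop, ← Mfil_eq_cyc, Mfil_zero])
  have h1 := pvFrom_le_of_span_eq s hρ (gen_ne_zero s f'') he' he'' hspan
  have h2 := pvFrom_le_of_span_eq s hρ hl'0 he'' he' hspan.symm
  rw [pvFrom_zero, pvFrom_zero] at h1 h2
  exact ⟨le_antisymm (fun x hx => (h1 x hx).1) fun x hx => (h2 x hx).1, fun x hx => (h1 x hx).2⟩

/-- A nonzero `l` in the smallest subspace `Vₖ` lies in every `Vᵢ`, so irreducibility gives `U(𝔤ᵢ) l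
= Vᵢ`. The map from `M(f)` sending the generator to `l` therefore respects the filtrations. -/
theorem exists_equivalent_Ms [CharZero K] [IsAlgClosed K] {A : FiltRep s} (hA : A.IsIrreducible) :
    ∃ f : Module.Dual K L, (Ms s f).Equivalent A := by
  obtain ⟨l, hl, hl0⟩ := Submodule.exists_mem_ne_zero_of_ne_bot (hA (Fin.last k)).1
  have hlU : ∀ i, l ∈ A.fil i := fun i => A.antitone (Fin.le_last i) hl
  have hirr : ∀ i W, Stable A.ρ.toLinearMap (s.ideal i) W → W ≤ A.fil i → W ≠ ⊥ → W = A.fil i :=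
    fun i W hW hWle h0 => ((hA i).2 W hWle hW).resolve_left h0
  obtain ⟨f, hf⟩ := exists_dual_isEig s (A.isRepOn _) A.fil A.invariant hl0 hlU hirr 0
  rw [pvFrom_zero] at hf
  obtain ⟨φ, hφ, hφx⟩ := exists_hom_ind (ρ := A.ρ) (χ := pvChar s f) (l := l) fun x => hf x x.2
  rw [← gen] at hφ
  have hcyc : ∀ i, cyc A.ρ.toLinearMap (s.ideal i) (K ∙ l) = A.fil i := fun i =>
    hirr i _ (stable_cyc _) (cyc_span_le (hlU i) (A.invariant i)) fun h0 =>
      hl0 ((Submodule.mem_bot K).1 (h0 ▸ mem_cyc_self l))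
  have hmap : ∀ i, (Mfil s f i).map φ = A.fil i := by
    intro i
    rw [Mfil_eq_cyc, ← hcyc i]
    refine le_antisymm (Submodule.map_le_iff_le_comap.2 (cyc_span_le ?_ fun y hy m hm => ?_))
      (cyc_span_le ⟨_, mem_cyc_self _, hφ⟩ ?_)
    · rw [Submodule.mem_comap, hφ]
      exact mem_cyc_self l
    · rw [Submodule.mem_comap, actM_apply, hφx]
      exact stable_cyc _ y hy _ hm
    · rintro y hy _ ⟨m, hm, rfl⟩
      exact ⟨_, stable_cyc _ y hy m hm, hφx y m⟩
  have hker : LinearMap.ker φ = ⊥ := by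
    refine ((Mfil_irreducible s f 0).2 (LinearMap.ker φ) ?_ fun x _ m hm => ?_).resolve_right
      fun h => ?_
    · rw [Mfil_zero]
      exact le_top
    · rw [LinearMap.mem_ker] at hm ⊢
      rw [actM_apply, hφx, hm, map_zero]
    · rw [Mfil_zero, LinearMap.ker_eq_top] at h
      exact hl0 (by rw [← hφ, h, LinearMap.zero_apply])
  have hrange : LinearMap.range φ = ⊤ := by
    rw [LinearMap.range_eq_map, ← Mfil_zero s f, hmap 0, A.fil_zero]
  exact ⟨f, LinearEquiv.ofBijective φ
    ⟨LinearMap.ker_eq_bot.1 hker, LinearMap.range_eq_top.1 hrange⟩,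
    hmap, hφx⟩

end FiltRep

end FiltLie

end

/-! ### The equivalences and the classification -/

theorem theorem3p4 {K : Type u} [Field K] [CharZero K] {L : Type v} [LieRing L] [LieAlgebra K L]
    {k : ℕ} (s : FiltLie.Filtration K L k) :
    (∀ f' f'' : Module.Dual K L, List.TFAE [
      Nonempty (FiltLie.M s f' ≃ₗ[UniversalEnvelopingAlgebra K L] FiltLie.M s f''),
      (FiltLie.Ms s f').Equivalent (FiltLie.Ms s f''),
      FiltLie.pv s f' = FiltLie.pv s f'' ∧ ∀ x ∈ FiltLie.pv s f', f' x = f'' x]) ∧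
    ∃ (hirr : ∀ f : Module.Dual K L, (FiltLie.Ms s f).IsIrreducible)
      (Φ : Quotient (FiltLie.relR s) → FiltLie.Irr s),
      (∀ f : Module.Dual K L,
        Φ (Quotient.mk (FiltLie.relR s) f) = FiltLie.Irr.mk (FiltLie.Ms s f) (hirr f)) ∧
      Function.Injective Φ ∧ (IsAlgClosed K → Function.Bijective Φ) := by
  have h21 : ∀ f' f'' : Module.Dual K L, (FiltLie.Ms s f').Equivalent (FiltLie.Ms s f'') →
      Nonempty (FiltLie.M s f' ≃ₗ[UniversalEnvelopingAlgebra K L] FiltLie.M s f'') := by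
    rintro f' f'' ⟨C, -, hC⟩
    exact ⟨{ C with map_smul' := FiltLie.smul_equiv s C hC }⟩
  have h13 : ∀ f' f'' : Module.Dual K L,
      Nonempty (FiltLie.M s f' ≃ₗ[UniversalEnvelopingAlgebra K L] FiltLie.M s f'') →
      FiltLie.pv s f' = FiltLie.pv s f'' ∧ ∀ x ∈ FiltLie.pv s f', f' x = f'' x :=
    fun _ _ ⟨C⟩ => FiltLie.relR_of_linearEquiv s C
  refine ⟨fun f' f'' => ?_, FiltLie.Ms_isIrreducible s, Quotient.lift
    (fun f => FiltLie.Irr.mk (FiltLie.Ms s f) (FiltLie.Ms_isIrreducible s f))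
    (fun f' f'' h => Quotient.sound (FiltLie.equivalent_of_relR s h)), fun _ => rfl, ?_⟩
  · tfae_have 2 → 1 := h21 f' f''
    tfae_have 1 → 3 := h13 f' f''
    tfae_have 3 → 2 := FiltLie.equivalent_of_relR s
    tfae_finish
  have hinj : Function.Injective (Quotient.lift (s := FiltLie.relR s)
      (fun f => FiltLie.Irr.mk (FiltLie.Ms s f) (FiltLie.Ms_isIrreducible s f))
      (fun f' f'' h => Quotient.sound (FiltLie.equivalent_of_relR s h))) := by
    intro a b
    induction a using Quotient.inductionOn with | _ f' =>
    induction b using Quotient.inductionOn with | _ f'' =>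
    intro h
    exact Quotient.sound (h13 f' f'' (h21 f' f'' (Quotient.exact h)))
  refine ⟨hinj, fun _ => ⟨hinj, fun a => ?_⟩⟩
  induction a using Quotient.inductionOn with | _ A =>
  obtain ⟨f, hf⟩ := FiltLie.exists_equivalent_Ms s A.2
  exact ⟨Quotient.mk _ f, Quotient.sound hf⟩
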